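/- There is an algorithm which, given multiplicatively independent integers $\alpha,\beta>1$ (that is, $\alpha^{n_1}=\beta^{n_2}$ with $n_1,n_2\in\mathbb{N}$ implies $n_1=n_2=0$, where $\mathbb{N}=\{0,1,2,\dots\}$), an integer $l\ge 1$, numbers $z_1,\dots,z_l\in\{\alpha,\beta\}$, an integer $r>0$ and a matrix $A\in\mathbb{Z}^{r\times l}$, decides whether there exist $n_1,\dots,n_l\in\mathbb{N}$ such that every coordinate of $A\mathbf{z}$ is strictly positive, where $\mathbf{z}=(z_1^{n_1},\dots,z_l^{n_l})$. -/

import Mathlib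

/-- `α` and `β` are multiplicatively independent: both are non-zero, and `α ^ n₁ = β ^ n₂` with
natural exponents only for `n₁ = n₂ = 0`. -/
def MultiplicativelyIndependent (α β : ℕ) : Prop :=
  α ≠ 0 ∧ β ≠ 0 ∧ ∀ n₁ n₂ : ℕ, α ^ n₁ = β ^ n₂ → n₁ = 0 ∧ n₂ = 0

/-- The inequality problem for bases `z` and matrix `A`: some exponents `n₁, …, n_l ∈ ℕ` make every
coordinate of `A (z₁ ^ n₁, …, z_l ^ n_l)` positive. -/
def PureIneqSolvable {r l : ℕ} (z : Fin l → ℕ) (A : Matrix (Fin r) (Fin l) ℤ) : Prop :=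
  ∃ n : Fin l → ℕ, ∀ i : Fin r, 0 < (A.mulVec fun j => (z j : ℤ) ^ n j) i

/-- The finite data presented to an algorithm: the two numbers, the list of bases, and the matrix
as the list of its rows. -/
abbrev PureIneqInput : Type := ℕ × ℕ × List ℕ × List (List ℤ)

/-- The input that presents the problem with parameters `α`, `β`, `z`, `A`. -/
def pureIneqInput {r l : ℕ} (α β : ℕ) (z : Fin l → ℕ) (A : Matrix (Fin r) (Fin l) ℤ) :
    PureIneqInput :=
  (α, β, List.ofFn z, List.ofFn fun i => List.ofFn (A i))

/-! Raising all exponents over `α` by `N` and all exponents over `β` by `m` multiplies the two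
groups of variables by `α ^ N` and `β ^ m`. Since `log α / log β` is irrational, the ratio of these
factors approximates every positive real. So the problem may be relaxed to powers carrying two free
scales `t`, `s`, one per base: a relaxed integer solution becomes a genuine one once `α ^ N : β ^ m`
is close enough to `t : s` (`ExistsBoundedPoint.exists_pow`).

The core is a bound for relaxed solutions, by induction on the number of variables
(`ExistsRealPoint.existsBoundedPoint`). Given any real solution, a gap in the sizes of its terms
separates a leading group `T` from negligible terms. After normalization `T` has boundedly many
shapes, and its two scales may be replaced by a small integer pair `(q, p)` at which every row is
weakly positive on `T`. Rows positive there are safe. Rows vanishing there depend on the lower terms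
and on a perturbation of the ratio; eliminating the perturbation leaves a system in fewer variables,
with bounded coefficients (`ExistsRealPoint.exists_leading`). A bounded solution of that system is
glued back under `T`, the approximation property aligning the scales of the two layers
(`ExistsBoundedPoint.glue`).

The resulting exponent bound iterates any sufficiently fast growing function `Φ` that bounds the
exponents needed for approximation. Such a `Φ` is found by unbounded search, which terminates
because approximations exist. What remains is a finite search below a computable bound. -/

/-! ### Integer inequalities in one ratio -/

/-- A homogeneous system of two-term inequalities with small integer coefficients that almost holds
at a positive real point holds weakly at a positive integer point of bounded size. -/
theorem exists_nat_nonneg_of_almost_nonneg {M : ℕ} (hM : 1 ≤ M) {S : Set (ℤ × ℤ)}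
    (hS : ∀ x ∈ S, |x.1| ≤ M ∧ |x.2| ≤ M) {t s η : ℝ} (ht : 0 < t) (hs : 0 < s)
    (htη : 2 * M * η ≤ t) (hsη : 2 * M * η ≤ s)
    (h : ∀ x ∈ S, -η < x.1 * t + x.2 * s) :
    ∃ p q : ℕ, 1 ≤ p ∧ p ≤ M ∧ 1 ≤ q ∧ q ≤ M ∧ ∀ x ∈ S, 0 ≤ x.1 * (q : ℤ) + x.2 * (p : ℤ) := by
  have hM' : (1 : ℝ) ≤ M := by exact_mod_cast hM
  have hηt : η < t := by nlinarith
  have hηs : η < s := by nlinarith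
  have hb0 : ∀ x ∈ S, x.2 ≤ 0 → 0 ≤ x.1 := by
    intro x hx hx2
    by_contra hneg
    have h1 : (x.1 : ℝ) ≤ -1 := by exact_mod_cast (by omega : x.1 ≤ -1)
    have h2 : (x.2 : ℝ) ≤ 0 := by exact_mod_cast hx2
    have := h x hx
    nlinarith
  by_cases hneg : ∃ x ∈ S, x.2 < 0
  · have hfin : {x ∈ S | x.2 < 0}.Finite := by
      refine (Set.finite_Icc ((-M, -M) : ℤ × ℤ) (M, M)).subset ?_
      rintro x ⟨hx, -⟩
      obtain ⟨h1, h2⟩ := hS x hx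
      rw [abs_le] at h1 h2
      exact ⟨⟨h1.1, h2.1⟩, ⟨h1.2, h2.2⟩⟩
    -- Rows with negative second coefficient bound `s / t` from above; the tightest of these bounds,
    -- `y.1 / -y.2`, serves as `p / q`.
    obtain ⟨y, ⟨hyS, hy⟩, hmin⟩ := Set.exists_min_image _
      (fun x : ℤ × ℤ => (x.1 : ℚ) / (-x.2 : ℤ)) hfin (by obtain ⟨x, hx⟩ := hneg; exact ⟨x, hx⟩)
    have hy1 : 1 ≤ y.1 := by
      by_contra hlt
      have hz : y.1 ≤ 0 := by omega
      have h1 : (y.1 : ℝ) ≤ 0 := by exact_mod_cast hz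
      have h2 : (y.2 : ℝ) ≤ -1 := by exact_mod_cast (by omega : y.2 ≤ -1)
      have := h y hyS
      nlinarith
    obtain ⟨hyM1, hyM2⟩ := hS y hyS
    rw [abs_le] at hyM1 hyM2
    refine ⟨y.1.toNat, (-y.2).toNat, by omega, by omega, by omega, by omega, fun x hx => ?_⟩
    rw [Int.toNat_of_nonneg (by omega), Int.toNat_of_nonneg (by omega)]
    rcases lt_trichotomy x.2 0 with hx2 | hx2 | hx2
    · have := hmin x ⟨hx, hx2⟩
      rw [div_le_div_iff₀ (by exact_mod_cast (by omega : 0 < -y.2))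
        (by exact_mod_cast (by omega : 0 < -x.2))] at this
      have h3 : y.1 * -x.2 ≤ x.1 * -y.2 := by exact_mod_cast this
      linarith
    · have := hb0 x hx hx2.le
      rw [hx2]
      nlinarith
    -- A violation is at least 1 by integrality, whereas eliminating `s` between the rows `x` and
    -- `y` bounds `t` times the same expression below by `-2 * M * η ≥ -t`, strictly.
    · by_contra hlt
      have hle : x.1 * -y.2 + x.2 * y.1 ≤ -1 := by omega
      have hle' : (x.1 : ℝ) * -y.2 + x.2 * y.1 ≤ -1 := by exact_mod_cast hle
      obtain ⟨hxM1, hxM2⟩ := hS x hx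
      rw [abs_le] at hxM2
      have e1 := h x hx
      have e2 := h y hyS
      have c1 : (0 : ℝ) < -y.2 := by exact_mod_cast (by omega : 0 < -y.2)
      have c2 : (0 : ℝ) < x.2 := by exact_mod_cast hx2
      have c3 : (x.2 : ℝ) ≤ M := by exact_mod_cast hxM2.2
      have c4 : -(y.2 : ℝ) ≤ M := by exact_mod_cast (by omega : -y.2 ≤ M)
      have k1 := mul_lt_mul_of_pos_left e1 c1
      have k2 := mul_lt_mul_of_pos_left e2 c2
      have k3 : t * ((x.1 : ℝ) * -y.2 + x.2 * y.1) ≤ t * (-1) :=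
        mul_le_mul_of_nonneg_left hle' ht.le
      by_cases hη : 0 ≤ η
      · nlinarith [mul_le_mul_of_nonneg_right c3 hη, mul_le_mul_of_nonneg_right c4 hη]
      · push Not at hη
        nlinarith
  · push Not at hneg
    refine ⟨M, 1, hM, le_rfl, le_rfl, hM, fun x hx => ?_⟩
    obtain ⟨h1, h2⟩ := hS x hx
    rw [abs_le] at h1 h2
    rcases (hneg x hx).eq_or_lt with h0 | h0
    · have := hb0 x hx h0.symm.le
      rw [← h0]
      simpa using this
    · have : (M : ℤ) ≤ x.2 * M := le_mul_of_one_le_left (by positivity) h0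
      push_cast
      linarith [h1.1]

/-- Fourier–Motzkin elimination of one variable from a system of bounded integer inequalities,
with a bound for the eliminated variable. -/
theorem exists_rat_of_combinations_pos {M V : ℕ} (hMV : M ≤ V) (hM : 1 ≤ M) {S : Set (ℤ × ℤ)}
    (hS : ∀ x ∈ S, |x.1| ≤ M ∧ |x.2| ≤ V)
    (h : ∀ x ∈ S, ∀ y ∈ S, ∀ m n : ℕ, m ≤ M → n ≤ M → (0 < m ∨ 0 < n) →
      m * x.1 + n * y.1 = 0 → 0 < m * x.2 + n * y.2) :
    ∃ (d : ℤ) (D : ℕ), 1 ≤ D ∧ D ≤ M * (V + 1) ∧ |d| ≤ (V + 1) ^ 2 + 1 ∧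
      ∀ x ∈ S, 1 ≤ x.1 * d + x.2 * (D : ℤ) := by
  -- The extra row imposes `d / D > -(V + 1)`, so that a largest lower bound exists even if no row
  -- has positive first coefficient.
  set S' : Set (ℤ × ℤ) := insert (1, (V : ℤ) + 1) {x ∈ S | 0 < x.1} with hS'
  have hpos : ∀ x ∈ S', 0 < x.1 := by
    rintro x (rfl | ⟨-, hx⟩)
    · simp
    · exact hx
  have hfin : S'.Finite := by
    refine Set.Finite.insert _ ((Set.finite_Icc ((-M, -V) : ℤ × ℤ) (M, V)).subset ?_)
    rintro x ⟨hx, -⟩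
    obtain ⟨h1, h2⟩ := hS x hx
    rw [abs_le] at h1 h2
    exact ⟨⟨h1.1, h2.1⟩, ⟨h1.2, h2.2⟩⟩
  obtain ⟨y, hyS, hmax⟩ := Set.exists_max_image S'
    (fun x : ℤ × ℤ => -(x.2 : ℚ) / x.1) hfin ⟨_, Set.mem_insert _ _⟩
  have hy0 := hpos y hyS
  have hyb : y.1 ≤ M ∧ |y.2| ≤ V + 1 := by
    rcases hyS with rfl | ⟨hy, -⟩
    · refine ⟨by simpa using hM, ?_⟩
      simp only
      rw [abs_of_nonneg (by positivity)]
    · obtain ⟨h1, h2⟩ := hS y hy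
      exact ⟨(le_abs_self _).trans h1, by linarith⟩
  -- Here `d / D = -y.2 / y.1 + 1 / D`, just above the largest lower bound. For an upper-bound row,
  -- the combination with `y` is an integer at least 1; its factor `V + 1` absorbs the loss `x.1 ≥
  -- -M ≥ -V`.
  refine ⟨-y.2 * (V + 1) + 1, y.1.toNat * (V + 1), ?_, ?_, ?_, fun x hx => ?_⟩
  · have : 1 ≤ y.1.toNat := by omega
    nlinarith
  · exact Nat.mul_le_mul_right _ (by omega)
  · obtain ⟨h1, h2⟩ := abs_le.mp hyb.2
    rw [abs_le]
    constructor <;> nlinarith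
  · push_cast
    rw [Int.toNat_of_nonneg hy0.le]
    obtain ⟨hxM, hxV⟩ := hS x hx
    rw [abs_le] at hxM hxV
    rcases lt_trichotomy x.1 0 with h0 | h0 | h0
    · have key : 1 ≤ x.2 * y.1 + y.2 * -x.1 := by
        rcases hyS with rfl | ⟨hy, -⟩
        · simp only
          nlinarith
        · have := h x hx y hy y.1.toNat (-x.1).toNat (by omega) (by omega) (by omega)
          rw [Int.toNat_of_nonneg hy0.le, Int.toNat_of_nonneg (by omega)] at this
          have := this (by ring)
          linarith
      have hV : (0 : ℤ) ≤ V := by positivity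
      have hMV' : (M : ℤ) ≤ V := by exact_mod_cast hMV
      nlinarith [mul_le_mul_of_nonneg_right key (by linarith : (0 : ℤ) ≤ V + 1)]
    · have := h x hx x hx 1 0 hM (Nat.zero_le _) (by simp) (by simp [h0])
      rw [h0]
      simp only [Nat.cast_one, one_mul, Nat.cast_zero, zero_mul, add_zero] at this
      have h1 : 1 ≤ y.1 * ((V : ℤ) + 1) := by nlinarith
      nlinarith
    · have := hmax x (Set.mem_insert_of_mem _ ⟨hx, h0⟩)
      rw [div_le_div_iff₀ (by exact_mod_cast h0) (by exact_mod_cast hy0)] at this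
      have h3 : -x.2 * y.1 ≤ -y.2 * x.1 := by exact_mod_cast this
      have hV : (0 : ℤ) ≤ (V : ℤ) + 1 := by positivity
      nlinarith [mul_le_mul_of_nonneg_right h3 hV]

/-! ### Separation of sizes -/

/-- Among the superlevel sets of a positive function on a finite set, for an increasing sequence
of thresholds relative to the maximum, two consecutive ones agree. -/
theorem exists_gap {ι : Type*} [DecidableEq ι] {J : Finset ι} (hJ : J.Nonempty) {w : ι → ℝ}
    (hw : ∀ j ∈ J, 0 < w j) {Θ : ℕ → ℕ} (hΘ : Monotone Θ) (h1 : 1 ≤ Θ 0) :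
    ∃ W > 0, ∃ k < J.card, ∃ T ⊆ J, T.Nonempty ∧ (∀ j ∈ J, w j ≤ W) ∧
      (∀ j ∈ T, W ≤ w j * Θ k) ∧ ∀ j ∈ J \ T, w j * Θ (k + 1) < W := by
  obtain ⟨i, hi, hmax⟩ := J.exists_max_image w hJ
  set T : ℕ → Finset ι := fun k => J.filter fun j => w i ≤ w j * Θ k with hT
  have hi0 : i ∈ T 0 := by
    simp only [hT, Finset.mem_filter]
    exact ⟨hi, le_mul_of_one_le_right (hw i hi).le (by exact_mod_cast h1)⟩
  have hmono : Monotone T := by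
    intro a b hab j hj
    simp only [hT, Finset.mem_filter] at hj ⊢
    refine ⟨hj.1, hj.2.trans (mul_le_mul_of_nonneg_left ?_ (hw j hj.1).le)⟩
    exact_mod_cast hΘ hab
  -- A chain of `J.card + 1` nonempty nested subsets of `J` cannot be strictly increasing.
  have hex : ∃ k < J.card, T k = T (k + 1) := by
    by_contra! hne
    have hcard : ∀ k ≤ J.card, k + 1 ≤ (T k).card := by
      intro k
      induction k with
      | zero => intro _; exact Finset.card_pos.mpr ⟨i, hi0⟩
      | succ k ih =>
        intro hk
        have := Finset.card_lt_card
          ((hmono (Nat.le_add_right k 1)).lt_of_ne (hne k (by omega)))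
        have := ih (by omega)
        omega
    have h2 := hcard _ le_rfl
    have h3 : (T J.card).card ≤ J.card := Finset.card_le_card (Finset.filter_subset _ _)
    omega
  obtain ⟨k, hk, hTk⟩ := hex
  refine ⟨w i, hw i hi, k, hk, T k, Finset.filter_subset _ _, ⟨i, hmono (Nat.zero_le k) hi0⟩, hmax,
    fun j hj => (Finset.mem_filter.mp hj).2, fun j hj => ?_⟩
  rw [hTk, Finset.mem_sdiff] at hj
  by_contra! hle
  exact hj.2 (Finset.mem_filter.mpr ⟨hj.1, hle⟩)

/-- Scaled powers of comparable size can be written with small natural exponents. -/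
theorem exists_normalized_exponents {ι : Type*} {γ : ℕ} (hγ : 1 < γ) (S : Finset ι) (e : ι → ℤ)
    {t W : ℝ} (ht : 0 < t) (hW : 0 < W) {Θ : ℕ} (hΘ : 1 ≤ Θ)
    (hlow : ∀ j ∈ S, W ≤ t * (γ : ℝ) ^ e j * Θ) (hup : ∀ j ∈ S, t * (γ : ℝ) ^ e j ≤ W) :
    ∃ t' > 0, ∃ f : ι → ℕ, W ≤ t' * Θ ∧
      ∀ j ∈ S, γ ^ f j ≤ Θ ∧ t' * (γ : ℝ) ^ f j = t * (γ : ℝ) ^ e j := by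
  have hγ0 : (0 : ℝ) < γ := by exact_mod_cast (by omega : 0 < γ)
  rcases S.eq_empty_or_nonempty with rfl | hS
  · exact ⟨W, hW, 0, le_mul_of_one_le_right hW.le (by exact_mod_cast hΘ), by simp⟩
  -- The smallest power is absorbed into the scale; the remaining factors are quotients of
  -- comparable terms, hence at most `Θ`.
  · obtain ⟨i, hi, hmin⟩ := S.exists_min_image e hS
    have heq : ∀ j ∈ S, t * (γ : ℝ) ^ e i * (γ : ℝ) ^ (e j - e i).toNat = t * (γ : ℝ) ^ e j := by
      intro j hj
      have := hmin j hj
      rw [mul_assoc, ← zpow_natCast, ← zpow_add₀ hγ0.ne', Int.toNat_of_nonneg (by omega)]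
      congr 2
      ring
    have hpos : 0 < t * (γ : ℝ) ^ e i := by positivity
    refine ⟨t * (γ : ℝ) ^ e i, hpos, fun j => (e j - e i).toNat, hlow i hi,
      fun j hj => ⟨?_, heq j hj⟩⟩
    have : t * (γ : ℝ) ^ e i * (γ : ℝ) ^ (e j - e i).toNat ≤ t * (γ : ℝ) ^ e i * Θ := by
      rw [heq j hj]
      exact (hup j hj).trans (hlow i hi)
    exact_mod_cast le_of_mul_le_mul_left this hpos

/-! ### The relaxed problem with two scales -/

/-- The value `∑ j ∈ S, r j * γ ^ e j` of a linear form at powers of `γ`. -/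
def expSum {ι : Type*} (γ : ℕ) (S : Finset ι) (e : ι → ℕ) (r : ι → ℤ) : ℤ :=
  ∑ j ∈ S, r j * (γ : ℤ) ^ e j

/-- Some scaled powers, with integer exponents and one positive real scale for each of the two
bases, make every linear form in `R` positive. -/
def ExistsRealPoint {ι : Type*} (α β : ℕ) (c : ι → Bool) (J : Finset ι) (R : Set (ι → ℤ)) : Prop :=
  ∃ (e : ι → ℤ) (t s : ℝ), 0 < t ∧ 0 < s ∧
    ∀ r ∈ R, 0 < ∑ j ∈ J, (r j : ℝ) * (if c j then t * (α : ℝ) ^ e j else s * (β : ℝ) ^ e j)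

/-- Some scaled powers, with natural exponents and natural scales bounded by `B`, make every linear
form in `R` positive. -/
def ExistsBoundedPoint {ι : Type*} (α β : ℕ) (c : ι → Bool) (J : Finset ι) (R : Set (ι → ℤ))
    (B : ℕ) : Prop :=
  ∃ (e : ι → ℕ) (t s : ℕ), (∀ j, e j ≤ B) ∧ 1 ≤ t ∧ t ≤ B ∧ 1 ≤ s ∧ s ≤ B ∧
    ∀ r ∈ R, 0 < ∑ j ∈ J, r j * (if c j then (t : ℤ) * (α : ℤ) ^ e j else s * (β : ℤ) ^ e j)

theorem ExistsBoundedPoint.mono {ι : Type*} {α β : ℕ} {c : ι → Bool} {J : Finset ι}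
    {R : Set (ι → ℤ)} {B B' : ℕ} (h : ExistsBoundedPoint α β c J R B) (hB : B ≤ B') :
    ExistsBoundedPoint α β c J R B' := by
  obtain ⟨e, t, s, he, ht, ht', hs, hs', hr⟩ := h
  exact ⟨e, t, s, fun j => (he j).trans hB, ht, ht'.trans hB, hs, hs'.trans hB, hr⟩

theorem sum_mul_ite_scaled {ι K : Type*} [CommRing K] (c : ι → Bool) (J : Finset ι) (r x y : ι → K)
    (t s : K) :
    ∑ j ∈ J, r j * (if c j then t * x j else s * y j) =
      t * ∑ j ∈ J with c j, r j * x j + s * ∑ j ∈ J with ¬ c j, r j * y j := by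
  rw [← Finset.sum_filter_add_sum_filter_not J (fun j => c j = true), Finset.mul_sum,
    Finset.mul_sum]
  congr 1
  · refine Finset.sum_congr rfl fun j hj => ?_
    rw [if_pos (Finset.mem_filter.mp hj).2]
    ring
  · refine Finset.sum_congr rfl fun j hj => ?_
    rw [if_neg (Finset.mem_filter.mp hj).2]
    ring

theorem abs_expSum_le {ι : Type*} {γ : ℕ} {S : Finset ι} {e : ι → ℕ} {r : ι → ℤ} {C n E : ℕ}
    (hn : S.card ≤ n) (hr : ∀ j ∈ S, |r j| ≤ C) (hE : ∀ j ∈ S, γ ^ e j ≤ E) :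
    |expSum γ S e r| ≤ n * C * E := by
  calc |expSum γ S e r| ≤ ∑ j ∈ S, |r j * (γ : ℤ) ^ e j| := Finset.abs_sum_le_sum_abs _ _
    _ ≤ ∑ _j ∈ S, (C : ℤ) * E := by
        refine Finset.sum_le_sum fun j hj => ?_
        rw [abs_mul, abs_of_nonneg (by positivity : (0 : ℤ) ≤ (γ : ℤ) ^ e j)]
        exact mul_le_mul (hr j hj) (by exact_mod_cast hE j hj) (by positivity) (by positivity)
    _ = S.card * (C * E) := by rw [Finset.sum_const, nsmul_eq_mul]
    _ ≤ n * (C * E) := by gcongr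
    _ = n * C * E := by ring

/-! ### Splitting off the leading variables -/

/-- The combinations of rows, from those that vanish at `(q, p)` on the leading variables `T`,
that do not involve a perturbation of `(q, p)`. -/
def reducedRows {ι : Type*} (α β : ℕ) (c : ι → Bool) (T : Finset ι) (f : ι → ℕ) (p q M : ℕ)
    (R : Set (ι → ℤ)) : Set (ι → ℤ) :=
  {v | ∃ r ∈ R, ∃ r' ∈ R, ∃ m n : ℕ, m ≤ M ∧ n ≤ M ∧ (0 < m ∨ 0 < n) ∧
    expSum α {j ∈ T | c j} f r * q + expSum β {j ∈ T | ¬ c j} f r * p = 0 ∧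
    expSum α {j ∈ T | c j} f r' * q + expSum β {j ∈ T | ¬ c j} f r' * p = 0 ∧
    m * expSum β {j ∈ T | ¬ c j} f r + n * expSum β {j ∈ T | ¬ c j} f r' = 0 ∧
    v = fun j => m * r j + n * r' j}

theorem abs_reducedRows_le {ι : Type*} {α β : ℕ} {c : ι → Bool} {T : Finset ι} {f : ι → ℕ}
    {p q M C : ℕ} {R : Set (ι → ℤ)} (hR : ∀ r ∈ R, ∀ j, |r j| ≤ C) :
    ∀ v ∈ reducedRows α β c T f p q M R, ∀ j, |v j| ≤ (2 * M * C : ℕ) := by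
  rintro v ⟨r, hr, r', hr', m, n, hm, hn, -, -, -, -, rfl⟩ j
  have h1 : |(m : ℤ) * r j| ≤ M * C := by
    rw [abs_mul, Nat.abs_cast]
    exact mul_le_mul (by exact_mod_cast hm) (hR r hr j) (abs_nonneg _) (by positivity)
  have h2 : |(n : ℤ) * r' j| ≤ M * C := by
    rw [abs_mul, Nat.abs_cast]
    exact mul_le_mul (by exact_mod_cast hn) (hR r' hr' j) (abs_nonneg _) (by positivity)
  have := abs_add_le ((m : ℤ) * r j) (n * r' j)
  push_cast
  linarith

/-- A real solution has a group of leading variables of bounded shape; the remaining variables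
solve the reduced system. -/
theorem ExistsRealPoint.exists_leading {ι : Type*} [DecidableEq ι] {α β : ℕ} (hα : 1 < α)
    (hβ : 1 < β) {c : ι → Bool} {J : Finset ι} (hJ : J.Nonempty) {R : Set (ι → ℤ)} {C X : ℕ}
    (hJC : J.card ≤ C) (hR : ∀ r ∈ R, ∀ j, |r j| ≤ C) {Θ : ℕ → ℕ} (hΘ : Monotone Θ)
    (h1 : 1 ≤ Θ 0) (hΘC : ∀ k, 2 * C ^ 4 * Θ k ^ 2 ≤ Θ (k + 1))
    (hX : ∀ k < J.card, Θ k ≤ X) (h : ExistsRealPoint α β c J R) :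
    ∃ T ⊆ J, T.Nonempty ∧ ∃ f : ι → ℕ, (∀ j, f j ≤ X) ∧ ∃ p q : ℕ, 1 ≤ p ∧ p ≤ C ^ 2 * X ∧
      1 ≤ q ∧ q ≤ C ^ 2 * X ∧
      (∀ r ∈ R, |expSum β {j ∈ T | ¬ c j} f r| ≤ (C ^ 2 * X : ℕ) ∧
        0 ≤ expSum α {j ∈ T | c j} f r * q + expSum β {j ∈ T | ¬ c j} f r * p) ∧
      ExistsRealPoint α β c (J \ T) (reducedRows α β c T f p q (C ^ 2 * X) R) := by
  obtain ⟨e, t, s, ht, hs, hpos⟩ := h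
  have hα0 : (0 : ℝ) < α := by exact_mod_cast (by omega : 0 < α)
  have hβ0 : (0 : ℝ) < β := by exact_mod_cast (by omega : 0 < β)
  set w : ι → ℝ := fun j => if c j then t * (α : ℝ) ^ e j else s * (β : ℝ) ^ e j with hw
  have hw0 : ∀ j, 0 < w j := by
    intro j
    simp only [hw]
    split_ifs <;> positivity
  obtain ⟨W, hW, k, hk, T, hTJ, hT, hup, hlow, hgap⟩ := exists_gap hJ (fun j _ => hw0 j) hΘ h1
  have hΘk : 1 ≤ Θ k := h1.trans (hΘ (Nat.zero_le k))
  have hC : 1 ≤ C := (Finset.card_pos.mpr hJ).trans_le hJC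
  have hwα : ∀ j, c j = true → w j = t * (α : ℝ) ^ e j := fun j hj => by simp [hw, hj]
  have hwβ : ∀ j, ¬ c j = true → w j = s * (β : ℝ) ^ e j := fun j hj => by simp [hw, hj]
  obtain ⟨t₁, ht₁, f₁, ht₁W, hf₁⟩ := exists_normalized_exponents hα {j ∈ T | c j} e ht hW hΘk
    (fun j hj => by
      rw [Finset.mem_filter] at hj
      rw [← hwα j hj.2]
      exact hlow j hj.1)
    (fun j hj => by
      rw [Finset.mem_filter] at hj
      rw [← hwα j hj.2]
      exact hup j (hTJ hj.1))
  obtain ⟨s₁, hs₁, f₂, hs₁W, hf₂⟩ := exists_normalized_exponents hβ {j ∈ T | ¬ c j} e hs hW hΘk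
    (fun j hj => by
      rw [Finset.mem_filter] at hj
      rw [← hwβ j hj.2]
      exact hlow j hj.1)
    (fun j hj => by
      rw [Finset.mem_filter] at hj
      rw [← hwβ j hj.2]
      exact hup j (hTJ hj.1))
  set f : ι → ℕ := fun j => if j ∈ T then (if c j then f₁ j else f₂ j) else 0 with hf
  have hfα : ∀ j ∈ ({j ∈ T | c j} : Finset ι), f j = f₁ j := by
    intro j hj
    rw [Finset.mem_filter] at hj
    simp [hf, hj.1, hj.2]
  have hfβ : ∀ j ∈ ({j ∈ T | ¬ c j} : Finset ι), f j = f₂ j := by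
    intro j hj
    rw [Finset.mem_filter] at hj
    simp [hf, hj.1, hj.2]
  have hfX : ∀ j, f j ≤ X := by
    intro j
    by_cases hj : j ∈ T
    · refine le_trans ?_ (hX k hk)
      by_cases hc : c j
      · have hm : j ∈ ({j ∈ T | c j} : Finset ι) := by simp [hj, hc]
        rw [hfα j hm]
        exact (Nat.lt_pow_self hα).le.trans (hf₁ j hm).1
      · have hm : j ∈ ({j ∈ T | ¬ c j} : Finset ι) := by simp [hj, hc]
        rw [hfβ j hm]
        exact (Nat.lt_pow_self hβ).le.trans (hf₂ j hm).1
    · simp [hf, hj]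
  set a : (ι → ℤ) → ℤ := expSum α {j ∈ T | c j} f with ha
  set b : (ι → ℤ) → ℤ := expSum β {j ∈ T | ¬ c j} f with hb
  set L : (ι → ℤ) → ℝ := fun r => ∑ j ∈ J \ T, (r j : ℝ) * w j with hL
  have hTsum : ∀ r : ι → ℤ, ∑ j ∈ T, (r j : ℝ) * w j = a r * t₁ + b r * s₁ := by
    intro r
    rw [hw, sum_mul_ite_scaled, ha, hb, expSum, expSum]
    push_cast
    rw [Finset.mul_sum, Finset.mul_sum, Finset.sum_mul, Finset.sum_mul]
    congr 1
    · refine Finset.sum_congr rfl fun j hj => ?_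
      rw [hfα j hj]
      linear_combination -(r j : ℝ) * (hf₁ j hj).2
    · refine Finset.sum_congr rfl fun j hj => ?_
      rw [hfβ j hj]
      linear_combination -(r j : ℝ) * (hf₂ j hj).2
  have hrow : ∀ r ∈ R, 0 < a r * t₁ + b r * s₁ + L r := by
    intro r hr
    have := hpos r hr
    rw [← Finset.sum_sdiff hTJ] at this
    rw [← hTsum, add_comm]
    exact this
  have hcardT : ∀ S ⊆ T, S.card ≤ C := fun S hS =>
    (Finset.card_le_card (hS.trans hTJ)).trans hJC
  have haM : ∀ r ∈ R, |a r| ≤ (C ^ 2 * Θ k : ℕ) := by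
    intro r hr
    have := abs_expSum_le (γ := α) (e := f) (E := Θ k) (hcardT _ (Finset.filter_subset (c · = true) T))
      (fun j _ => hR r hr j) (fun j hj => by rw [hfα j hj]; exact (hf₁ j hj).1)
    push_cast
    rwa [pow_two]
  have hbM : ∀ r ∈ R, |b r| ≤ (C ^ 2 * Θ k : ℕ) := by
    intro r hr
    have := abs_expSum_le (γ := β) (e := f) (E := Θ k)
      (hcardT _ (Finset.filter_subset (¬ c · = true) T))
      (fun j _ => hR r hr j) (fun j hj => by rw [hfβ j hj]; exact (hf₂ j hj).1)
    push_cast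
    rwa [pow_two]
  have hΘk' : (1 : ℝ) ≤ Θ k := by exact_mod_cast hΘk
  have hΘk1 : (0 : ℝ) < Θ (k + 1) := by
    exact_mod_cast h1.trans (hΘ (Nat.zero_le _))
  -- With `η = C ^ 2 * (W / Θ (k + 1))` the leading part of each row exceeds `-η`. For `M = C ^ 2 *
  -- Θ k`, the growth of `Θ` gives `2 * M * η ≤ W / Θ k`, which is at most `t₁` and `s₁`.
  have hLη : ∀ r ∈ R, L r ≤ C ^ 2 * (W / Θ (k + 1)) := by
    intro r hr
    calc L r ≤ ∑ _j ∈ J \ T, (C : ℝ) * (W / Θ (k + 1)) := by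
          refine Finset.sum_le_sum fun j hj => ?_
          have h2 : w j ≤ W / Θ (k + 1) := by
            rw [le_div_iff₀ hΘk1]
            exact (hgap j hj).le
          have h3 : (r j : ℝ) ≤ C := by exact_mod_cast (le_abs_self _).trans (hR r hr j)
          exact mul_le_mul h3 h2 (hw0 j).le (by positivity)
      _ = (J \ T).card * (C * (W / Θ (k + 1))) := by rw [Finset.sum_const, nsmul_eq_mul]
      _ ≤ C * (C * (W / Θ (k + 1))) := by
          gcongr
          exact (Finset.card_le_card Finset.sdiff_subset).trans hJC
      _ = C ^ 2 * (W / Θ (k + 1)) := by ring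
  have hMη : 2 * ((C ^ 2 * Θ k : ℕ) : ℝ) * (C ^ 2 * (W / Θ (k + 1))) * Θ k ≤ W := by
    have h2 : (2 * C ^ 4 * Θ k ^ 2 : ℝ) ≤ Θ (k + 1) := by exact_mod_cast hΘC k
    calc 2 * ((C ^ 2 * Θ k : ℕ) : ℝ) * (C ^ 2 * (W / Θ (k + 1))) * Θ k
        = (2 * C ^ 4 * Θ k ^ 2) * (W / Θ (k + 1)) := by push_cast; ring
      _ ≤ Θ (k + 1) * (W / Θ (k + 1)) := by gcongr
      _ = W := by field_simp
  have hΘpos : (0 : ℝ) < Θ k := by linarith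
  have hM1 : 1 ≤ C ^ 2 * Θ k := Nat.mul_pos (by positivity) hΘk
  obtain ⟨p, q, hp, hpM, hq, hqM, hpq⟩ := exists_nat_nonneg_of_almost_nonneg hM1
    (S := (fun r => (a r, b r)) '' R) (t := t₁) (s := s₁) (η := C ^ 2 * (W / Θ (k + 1)))
    (by rintro _ ⟨r, hr, rfl⟩; exact ⟨haM r hr, hbM r hr⟩) ht₁ hs₁
    (le_of_mul_le_mul_right (hMη.trans ht₁W) hΘpos) (le_of_mul_le_mul_right (hMη.trans hs₁W) hΘpos)
    (by
      rintro _ ⟨r, hr, rfl⟩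
      have h2 := hrow r hr
      have h3 := hLη r hr
      simp only
      linarith)
  have hMX : C ^ 2 * Θ k ≤ C ^ 2 * X := Nat.mul_le_mul_left _ (hX k hk)
  refine ⟨T, hTJ, hT, f, hfX, p, q, hp, hpM.trans hMX, hq, hqM.trans hMX, fun r hr =>
    ⟨(hbM r hr).trans (by exact_mod_cast hMX), hpq _ ⟨r, hr, rfl⟩⟩, e, t, s, ht, hs, ?_⟩
  rintro v ⟨r, hr, r', hr', m, n, -, -, hmn, hact, hact', hcomb, rfl⟩
  have hq0 : (0 : ℝ) < q := by exact_mod_cast hq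
  have hsum : ∑ j ∈ J \ T, (((m * r j + n * r' j : ℤ)) : ℝ) * w j = m * L r + n * L r' := by
    rw [hL, Finset.mul_sum, Finset.mul_sum, ← Finset.sum_add_distrib]
    refine Finset.sum_congr rfl fun j _ => ?_
    push_cast
    ring
  rw [hsum]
  have hact1 : (a r : ℝ) * q + b r * p = 0 := by exact_mod_cast hact
  have hact2 : (a r' : ℝ) * q + b r' * p = 0 := by exact_mod_cast hact'
  have hcomb1 : (m : ℝ) * b r + n * b r' = 0 := by exact_mod_cast hcomb
  have h2 := mul_pos hq0 (hrow r hr)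
  have h3 := mul_pos hq0 (hrow r' hr')
  -- Both rows satisfy `a * q = -b * p`, so a combination killing the `b` part kills the `a` part
  -- too: the leading terms cancel for the original real scales, and positivity passes to the lower
  -- terms.
  have hkey : (q : ℝ) * (m * L r + n * L r') =
      m * (q * (a r * t₁ + b r * s₁ + L r)) + n * (q * (a r' * t₁ + b r' * s₁ + L r')) := by
    linear_combination (-(m : ℝ) * t₁) * hact1 + (-(n : ℝ) * t₁) * hact2 +
      (p * t₁ - q * s₁) * hcomb1
  refine pos_of_mul_pos_right ?_ hq0.le
  rw [hkey]
  rcases hmn with hm | hn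
  · have : (0 : ℝ) < m := by exact_mod_cast hm
    positivity
  · have : (0 : ℝ) < n := by exact_mod_cast hn
    positivity

/-! ### Gluing a lower layer under the leading one -/

/-- For all positive `P, Q < x`, the numbers `P * α ^ N` and `Q * β ^ m` agree up to `β ^ m / x`
for some large exponents `N, m < b`. -/
def HasApproximation (α β x b : ℕ) : Prop :=
  ∀ P < x, ∀ Q < x, 0 < P → 0 < Q → ∃ N < b, ∃ m < b, x ≤ α ^ N ∧ x ≤ β ^ m ∧
    x * (P * α ^ N) < x * (Q * β ^ m) + β ^ m ∧ x * (Q * β ^ m) < x * (P * α ^ N) + β ^ m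

/-- Here `A`, `B` stand for `α ^ N`, `β ^ m`. The row equals `B` times an integer bracket, plus an
error `E * u` smaller than `B` by the approximation, so a bracket at least 1 suffices. If `a * q + b
* p > 0`, its first term is at least `A ≥ (V + 2) ^ 10` and dominates; otherwise the hypothesis on
`d / D` makes the second term positive. -/
theorem glued_row_pos {a b u y p q t s d D A B V x : ℤ} (hV : 0 ≤ V) (hu : |u| ≤ V)
    (hv : |t * y + s * u| ≤ V) (hb : |b| ≤ V) (hD : 1 ≤ D) (hDV : D ≤ V * (V + 1))
    (hd : |d| ≤ (V + 1) ^ 2 + 1) (hq : 1 ≤ q) (hqV : q ≤ V) (ht : 1 ≤ t)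
    (hx : (V + 2) ^ 10 ≤ x) (hxA : x ≤ A) (hxB : x ≤ B)
    (h1 : x * (p * t * A) < x * (q * s * B) + B) (h2 : x * (q * s * B) < x * (p * t * A) + B)
    (hab : 0 ≤ a * q + b * p) (hact : a * q + b * p = 0 → 1 ≤ b * d + (t * y + s * u) * D) :
    0 < a * (D * q * B * t * A) + b * ((D * (p * t) * A + q * d) * B) +
      (D * q * B * t * y + (D * (p * t) * A + q * d) * u) := by
  have hpow : 0 < (V + 2) ^ 10 := by positivity
  have hB : 0 < B := by linarith
  have hVpow : ∀ n ≤ 10, (V + 2) ^ n ≤ x := fun n hn =>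
    (pow_le_pow_right₀ (by linarith) hn).trans hx
  set Z := p * t * A - q * s * B with hZ
  set E := D * Z + q * d with hE
  have hZx : x * |Z| < B := by
    have hxZ : x * Z = x * (p * t * A) - x * (q * s * B) := by rw [hZ]; ring
    have : |x * Z| < B := by
      rw [abs_lt, hxZ]
      constructor <;> linarith
    rwa [abs_mul, abs_of_pos (hpow.trans_le hx)] at this
  have hqd : q * |d| ≤ V * ((V + 1) ^ 2 + 1) := mul_le_mul hqV hd (abs_nonneg _) hV
  have hEV : |E| * V < B := by
    have e1 : |E| ≤ D * |Z| + q * |d| := by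
      refine (abs_add_le _ _).trans (le_of_eq ?_)
      rw [abs_mul, abs_mul, abs_of_pos (by linarith : 0 < D), abs_of_pos (by linarith : 0 < q)]
    have e2 : 2 * D * V * |Z| ≤ x * |Z| := by
      refine mul_le_mul_of_nonneg_right ?_ (abs_nonneg _)
      have : D * V ≤ V * (V + 1) * V := mul_le_mul_of_nonneg_right hDV hV
      have := hVpow 4 (by norm_num)
      have : 2 * D * V ≤ x := by
        linarith [pow_nonneg hV 3, pow_nonneg hV 2, pow_nonneg hV 4]
      exact this
    have e3 : 2 * (q * |d|) * V ≤ x := by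
      have : q * |d| * V ≤ V * ((V + 1) ^ 2 + 1) * V := mul_le_mul_of_nonneg_right hqd hV
      have := hVpow 5 (by norm_num)
      linarith [pow_nonneg hV 3, pow_nonneg hV 2, pow_nonneg hV 4, pow_nonneg hV 5]
    have e4 : |E| * V ≤ (D * |Z| + q * |d|) * V := mul_le_mul_of_nonneg_right e1 hV
    linarith
  have hEu : -B < E * u := by
    have : |E * u| ≤ |E| * V := by
      rw [abs_mul]
      exact mul_le_mul_of_nonneg_left hu (abs_nonneg _)
    have := neg_abs_le (E * u)
    linarith
  have key : a * (D * q * B * t * A) + b * ((D * (p * t) * A + q * d) * B) +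
      (D * q * B * t * y + (D * (p * t) * A + q * d) * u) =
      B * (D * t * A * (a * q + b * p) + q * (b * d + (t * y + s * u) * D)) + E * u := by
    rw [hE, hZ]
    ring
  rw [key]
  suffices h : 1 ≤ D * t * A * (a * q + b * p) + q * (b * d + (t * y + s * u) * D) by
    nlinarith [mul_le_mul_of_nonneg_left h hB.le]
  rcases hab.eq_or_lt with h0 | h0
  · rw [← h0]
    have := hact h0.symm
    nlinarith
  · have hA : 0 < A := by linarith
    have hDt : 1 ≤ D * t := one_le_mul_of_one_le_of_one_le hD ht
    have e1 : A ≤ D * t * A * (a * q + b * p) := by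
      have : A ≤ D * t * A := le_mul_of_one_le_left hA.le hDt
      exact this.trans (le_mul_of_one_le_right (by linarith) h0)
    have e2 : |b * d + (t * y + s * u) * D| ≤ V * ((V + 1) ^ 2 + 1) + V * (V * (V + 1)) := by
      refine (abs_add_le _ _).trans ?_
      rw [abs_mul, abs_mul, abs_of_pos (by linarith : 0 < D)]
      exact add_le_add (mul_le_mul hb hd (abs_nonneg _) hV)
        (mul_le_mul hv hDV (by linarith) hV)
    have e3 := neg_abs_le (b * d + (t * y + s * u) * D)
    have e4 : -(V * (V * ((V + 1) ^ 2 + 1) + V * (V * (V + 1)))) ≤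
        q * (b * d + (t * y + s * u) * D) := by
      have e5 : q * |b * d + (t * y + s * u) * D| ≤
          V * (V * ((V + 1) ^ 2 + 1) + V * (V * (V + 1))) :=
        mul_le_mul hqV e2 (abs_nonneg _) hV
      have e6 := mul_le_mul_of_nonneg_left e3 (by linarith : 0 ≤ q)
      linarith
    have e6 := hVpow 5 (by norm_num)
    have e7 : V * (V * ((V + 1) ^ 2 + 1) + V * (V * (V + 1))) + 1 ≤ (V + 2) ^ 5 := by
      linarith [pow_nonneg hV 3, pow_nonneg hV 2, pow_nonneg hV 4, pow_nonneg hV 5]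
    linarith

set_option maxHeartbeats 800000 in
/-- A bounded solution of the reduced system extends to a bounded solution of the whole system. -/
theorem ExistsBoundedPoint.glue {ι : Type*} [DecidableEq ι] {α β : ℕ} (hα : 1 < α) (hβ : 1 < β)
    {c : ι → Bool} {J T : Finset ι} (hTJ : T ⊆ J) {R : Set (ι → ℤ)} {C X M V x b B B' : ℕ}
    (hJC : J.card ≤ C) (hR : ∀ r ∈ R, ∀ j, |r j| ≤ C) {f : ι → ℕ} (hf : ∀ j, f j ≤ X) {p q : ℕ}
    (hp : 1 ≤ p) (hpM : p ≤ M) (hq : 1 ≤ q) (hqM : q ≤ M)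
    (hrow : ∀ r ∈ R, |expSum β {j ∈ T | ¬ c j} f r| ≤ M ∧
      0 ≤ expSum α {j ∈ T | c j} f r * q + expSum β {j ∈ T | ¬ c j} f r * p)
    (h : ExistsBoundedPoint α β c (J \ T) (reducedRows α β c T f p q M R) B')
    (hMV : M ≤ V) (hB'V : B' ≤ V) (hαV : 2 * B' * (C * C * α ^ B') ≤ V)
    (hβV : 2 * B' * (C * C * β ^ B') ≤ V) (hx : (V + 2) ^ 10 ≤ x) (happ : HasApproximation α β x b)
    (hXB : X + b ≤ B) (hB'B : B' ≤ B) (hαB : (V + 2) ^ 6 * α ^ b ≤ B)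
    (hβB : (V + 2) ^ 6 * β ^ b ≤ B) :
    ExistsBoundedPoint α β c J R B := by
  obtain ⟨e, t, s, he, ht, htB, hs, hsB, hpos⟩ := h
  set a : (ι → ℤ) → ℤ := expSum α {j ∈ T | c j} f with ha
  set g : (ι → ℤ) → ℤ := expSum β {j ∈ T | ¬ c j} f with hg
  set y : (ι → ℤ) → ℤ := expSum α {j ∈ J \ T | c j} e with hy
  set u : (ι → ℤ) → ℤ := expSum β {j ∈ J \ T | ¬ c j} e with hu
  have hlow : ∀ r : ι → ℤ, ∑ j ∈ J \ T,
      r j * (if c j then (t : ℤ) * (α : ℤ) ^ e j else s * (β : ℤ) ^ e j) = t * y r + s * u r :=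
    fun r => sum_mul_ite_scaled _ _ _ _ _ _ _
  have hcard : ∀ S ⊆ J \ T, S.card ≤ C := fun S hS =>
    (Finset.card_le_card (hS.trans Finset.sdiff_subset)).trans hJC
  have hB'1 : 1 ≤ B' := ht.trans htB
  have hyle : ∀ r ∈ R, |y r| ≤ C * C * (α ^ B' : ℕ) := fun r hr =>
    abs_expSum_le (hcard _ (Finset.filter_subset (c · = true) _)) (fun j _ => hR r hr j)
      (fun j _ => Nat.pow_le_pow_right (by omega) (he j))
  have hule : ∀ r ∈ R, |u r| ≤ C * C * (β ^ B' : ℕ) := fun r hr =>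
    abs_expSum_le (hcard _ (Finset.filter_subset (¬ c · = true) _)) (fun j _ => hR r hr j)
      (fun j _ => Nat.pow_le_pow_right (by omega) (he j))
  have hαV' : 2 * B' * (C * C * (α ^ B' : ℕ)) ≤ (V : ℤ) := by exact_mod_cast hαV
  have hβV' : 2 * B' * (C * C * (β ^ B' : ℕ)) ≤ (V : ℤ) := by exact_mod_cast hβV
  have hB'1' : (1 : ℤ) ≤ B' := by exact_mod_cast hB'1
  have huV : ∀ r ∈ R, |u r| ≤ V := by
    intro r hr
    refine (hule r hr).trans (le_trans ?_ hβV')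
    exact le_mul_of_one_le_left (by positivity) (by linarith)
  have hvV : ∀ r ∈ R, |t * y r + s * u r| ≤ V := by
    intro r hr
    have e1 : |(t : ℤ) * y r| ≤ B' * (C * C * (α ^ B' : ℕ)) := by
      rw [abs_mul, Nat.abs_cast]
      exact mul_le_mul (by exact_mod_cast htB) (hyle r hr) (abs_nonneg _) (by positivity)
    have e2 : |(s : ℤ) * u r| ≤ B' * (C * C * (β ^ B' : ℕ)) := by
      rw [abs_mul, Nat.abs_cast]
      exact mul_le_mul (by exact_mod_cast hsB) (hule r hr) (abs_nonneg _) (by positivity)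
    have e3 := abs_add_le ((t : ℤ) * y r) (s * u r)
    linarith
  have hMV' : (M : ℤ) ≤ V := by exact_mod_cast hMV
  -- `d / D` is the perturbation of the leading ratio. Its solvability condition on the rows
  -- vanishing at `(q, p)` is precisely the reduced system.
  obtain ⟨d, D, hD, hDV, hd, hact⟩ := exists_rat_of_combinations_pos hMV (hp.trans hpM)
    (S := (fun r => (g r, t * y r + s * u r)) '' {r ∈ R | a r * q + g r * p = 0})
    (by
      rintro _ ⟨r, ⟨hr, -⟩, rfl⟩
      exact ⟨(hrow r hr).1, hvV r hr⟩)
    (by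
      rintro _ ⟨r, ⟨hr, hra⟩, rfl⟩ _ ⟨r', ⟨hr', hra'⟩, rfl⟩ m n hm hn hmn h0
      have := hpos _ ⟨r, hr, r', hr', m, n, hm, hn, hmn, hra, hra', h0, rfl⟩
      change 0 < (m : ℤ) * (t * y r + s * u r) + n * (t * y r' + s * u r')
      rw [← hlow, ← hlow, Finset.mul_sum, Finset.mul_sum, ← Finset.sum_add_distrib]
      refine this.trans_eq (Finset.sum_congr rfl fun j _ => ?_)
      ring)
  have hDV' : D ≤ V * (V + 1) := hDV.trans (Nat.mul_le_mul_right _ hMV)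
  have hVx : V * V < x := by
    refine lt_of_lt_of_le ?_ hx
    calc V * V < (V + 2) ^ 2 := by nlinarith
      _ ≤ (V + 2) ^ 10 := Nat.pow_le_pow_right (by omega) (by norm_num)
  have hPx : p * t < x :=
    (Nat.mul_le_mul (hpM.trans hMV) (htB.trans hB'V)).trans_lt hVx
  have hQx : q * s < x :=
    (Nat.mul_le_mul (hqM.trans hMV) (hsB.trans hB'V)).trans_lt hVx
  obtain ⟨N, hN, m, hm, hxN, hxm, happ1, happ2⟩ := happ (p * t) hPx (q * s) hQx
    (Nat.mul_pos hp ht) (Nat.mul_pos hq hs)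
  have hV0 : (0 : ℤ) ≤ V := by positivity
  have hqV : (q : ℤ) ≤ V := by exact_mod_cast hqM.trans hMV
  have hxz : ((V : ℤ) + 2) ^ 10 ≤ x := by exact_mod_cast hx
  have hxN' : (x : ℤ) ≤ (α : ℤ) ^ N := by exact_mod_cast hxN
  have hqd : |(q : ℤ) * d| ≤ V * ((V + 1) ^ 2 + 1) := by
    rw [abs_mul, Nat.abs_cast]
    exact mul_le_mul hqV hd (abs_nonneg _) hV0
  obtain ⟨hqd1, hqd2⟩ := abs_le.mp hqd
  have hVN : (V : ℤ) * ((V + 1) ^ 2 + 1) + 1 ≤ (α : ℤ) ^ N := by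
    refine le_trans ?_ (hxz.trans hxN')
    calc (V : ℤ) * ((V + 1) ^ 2 + 1) + 1 ≤ ((V : ℤ) + 2) ^ 3 := by
            linarith [pow_nonneg hV0 2, pow_nonneg hV0 3]
      _ ≤ ((V : ℤ) + 2) ^ 10 := pow_le_pow_right₀ (by linarith) (by norm_num)
  have hDpt : 1 ≤ D * (p * t) := Nat.mul_pos hD (Nat.mul_pos hp ht)
  have hDpt' : (1 : ℤ) ≤ D * (p * t) := by exact_mod_cast hDpt
  have hsF : 1 ≤ (D : ℤ) * (p * t) * (α : ℤ) ^ N + q * d := by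
    have : (α : ℤ) ^ N ≤ D * (p * t) * (α : ℤ) ^ N := le_mul_of_one_le_left (by positivity) hDpt'
    linarith
  obtain ⟨sF, hsFeq⟩ := Int.eq_ofNat_of_zero_le (zero_le_one.trans hsF)
  have hDptV : D * (p * t) ≤ V * (V + 1) * (V * V) :=
    Nat.mul_le_mul hDV' (Nat.mul_le_mul (hpM.trans hMV) (htB.trans hB'V))
  -- The lower layer has scales `D * q * t * β ^ m` and `D * p * t * α ^ N + q * d`, in ratio close
  -- to `t : s` because `p * t * α ^ N` is close to `q * s * β ^ m`. The shifts by `N` and `m` turn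
  -- the ratio on `T` into `q : p`, up to a perturbation proportional to `d / D`.
  refine ⟨fun j => if j ∈ T then (if c j then f j + N else f j + m) else e j,
    D * q * β ^ m * t, sF, ?_, ?_, ?_, ?_, ?_, ?_⟩
  · intro j
    have := hf j
    have := he j
    simp only
    split_ifs <;> omega
  · have : 1 ≤ β ^ m := Nat.one_le_pow _ _ (by omega)
    exact Nat.mul_pos (Nat.mul_pos (Nat.mul_pos hD hq) this) ht
  · refine le_trans ?_ hβB
    have e1 : D * q * t ≤ V * (V + 1) * V * V :=
      Nat.mul_le_mul (Nat.mul_le_mul hDV' (hqM.trans hMV)) (htB.trans hB'V)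
    have e2 : β ^ m ≤ β ^ b := Nat.pow_le_pow_right (by omega) hm.le
    have e3 : V * (V + 1) * V * V ≤ (V + 2) ^ 6 := by
      calc V * (V + 1) * V * V ≤ (V + 2) * (V + 2) * (V + 2) * (V + 2) := by gcongr <;> omega
        _ = (V + 2) ^ 4 := by ring
        _ ≤ (V + 2) ^ 6 := Nat.pow_le_pow_right (by omega) (by norm_num)
    calc D * q * β ^ m * t = D * q * t * β ^ m := by ring
      _ ≤ (V + 2) ^ 6 * β ^ b := Nat.mul_le_mul (e1.trans e3) e2
  · exact_mod_cast hsFeq ▸ hsF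
  · have e2 : α ^ N ≤ α ^ b := Nat.pow_le_pow_right (by omega) hN.le
    have e4 : V * (V + 1) * (V * V) + V * ((V + 1) ^ 2 + 1) ≤ (V + 2) ^ 6 := by
      calc V * (V + 1) * (V * V) + V * ((V + 1) ^ 2 + 1) ≤ (V + 2) ^ 4 := by
            linarith [Nat.zero_le (V ^ 2), Nat.zero_le (V ^ 3), Nat.zero_le (V ^ 4)]
        _ ≤ (V + 2) ^ 6 := Nat.pow_le_pow_right (by omega) (by norm_num)
    have e5 : 1 ≤ α ^ b := Nat.one_le_pow _ _ (by omega)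
    have e6 : (sF : ℤ) ≤ (V * (V + 1) * (V * V) * α ^ b + V * ((V + 1) ^ 2 + 1) : ℕ) := by
      have e7 : ((D * (p * t) * α ^ N : ℕ) : ℤ) ≤ (V * (V + 1) * (V * V) * α ^ b : ℕ) := by
        exact_mod_cast Nat.mul_le_mul hDptV e2
      push_cast at e7 ⊢
      have : (sF : ℤ) = D * (p * t) * (α : ℤ) ^ N + q * d := hsFeq.symm
      linarith
    have e8 : sF ≤ V * (V + 1) * (V * V) * α ^ b + V * ((V + 1) ^ 2 + 1) := by exact_mod_cast e6
    refine e8.trans (le_trans ?_ hαB)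
    calc V * (V + 1) * (V * V) * α ^ b + V * ((V + 1) ^ 2 + 1)
        ≤ V * (V + 1) * (V * V) * α ^ b + V * ((V + 1) ^ 2 + 1) * α ^ b :=
          Nat.add_le_add_left (Nat.le_mul_of_pos_right _ e5) _
      _ = (V * (V + 1) * (V * V) + V * ((V + 1) ^ 2 + 1)) * α ^ b := by ring
      _ ≤ (V + 2) ^ 6 * α ^ b := Nat.mul_le_mul_right _ e4
  · intro r hr
    have hfin := glued_row_pos (a := a r) (b := g r) (u := u r) (y := y r) (p := p) (q := q)
      (t := t) (s := s) (d := d) (D := D) (A := (α : ℤ) ^ N) (B := (β : ℤ) ^ m) (V := V) (x := x)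
      hV0 (huV r hr) (hvV r hr) ((hrow r hr).1.trans hMV') (by exact_mod_cast hD)
      (by exact_mod_cast hDV') hd (by exact_mod_cast hq) hqV (by exact_mod_cast ht) hxz hxN'
      (by exact_mod_cast hxm) (by exact_mod_cast happ1) (by exact_mod_cast happ2) (hrow r hr).2
      (fun h0 => hact _ ⟨r, ⟨hr, h0⟩, rfl⟩)
    refine hfin.trans_eq ?_
    rw [← Finset.sum_sdiff hTJ, add_comm]
    have hsF' : (sF : ℤ) = D * (p * t) * (α : ℤ) ^ N + q * d := hsFeq.symm
    congr 1
    · rw [hy, hu, expSum, expSum, ← sum_mul_ite_scaled]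
      refine Finset.sum_congr rfl fun j hj => ?_
      simp only [if_neg (Finset.mem_sdiff.mp hj).2, hsF']
      push_cast
      rfl
    · rw [ha, hg, expSum, expSum, mul_comm, mul_comm (∑ j ∈ T with ¬ c j, _),
        ← sum_mul_ite_scaled]
      refine Finset.sum_congr rfl fun j hj => ?_
      simp only [if_pos hj, hsF']
      push_cast
      split_ifs <;> ring

/-! ### A bound for relaxed solutions -/

/-- If `Φ` grows fast enough and bounds the exponents needed for approximations, then an iterate of
`Φ` bounds some solution of each solvable system. -/
theorem ExistsRealPoint.existsBoundedPoint {α β : ℕ} (hα : 1 < α) (hβ : 1 < β) {Φ : ℕ → ℕ}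
    (hΦ : ∀ x, HasApproximation α β x (Φ x)) (hgrow : ∀ x, (x + 2) ^ (x + 10) ≤ Φ x)
    {ι : Type*} [DecidableEq ι] {c : ι → Bool} (l : ℕ) :
    ∀ {J : Finset ι} {R : Set (ι → ℤ)} {C : ℕ}, J.card ≤ l → J.card ≤ C → 2 ≤ C → α ≤ C → β ≤ C →
      (∀ r ∈ R, ∀ j, |r j| ≤ C) → ExistsRealPoint α β c J R →
      ExistsBoundedPoint α β c J R (Φ^[(l + 3) ^ 2] C) := by
  have hpow : ∀ x n, n ≤ 10 → (x + 2) ^ n ≤ Φ x := fun x n hn =>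
    (Nat.pow_le_pow_right (by omega) (by omega)).trans (hgrow x)
  have hΦle : ∀ x, x ≤ Φ x := fun x => by
    have := hpow x 1 (by norm_num)
    rw [pow_one] at this
    omega
  have hiter : ∀ C, Monotone fun k => Φ^[k] C := fun C =>
    monotone_nat_of_le_succ fun k => by
      simp only [Function.iterate_succ_apply']
      exact hΦle _
  have hCiter : ∀ C k, C ≤ Φ^[k] C := fun C k => hiter C (Nat.zero_le k)
  induction l with
  | zero =>
    intro J R C hJ _ hC _ _ _ h
    obtain rfl : J = ∅ := Finset.card_eq_zero.mp (by omega)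
    obtain ⟨e, t, s, -, -, hpos⟩ := h
    have h1 : 1 ≤ Φ^[(0 + 3) ^ 2] C := (by omega : 1 ≤ C).trans (hCiter _ _)
    refine ⟨0, 1, 1, fun _ => Nat.zero_le _, le_rfl, h1, le_rfl, h1, fun r hr => ?_⟩
    simpa using hpos r hr
  | succ l ih =>
    intro J R C hJl hJC hC hαC hβC hR h
    have hbase : 1 ≤ Φ^[(l + 1 + 3) ^ 2] C := (by omega : 1 ≤ C).trans (hCiter _ _)
    rcases J.eq_empty_or_nonempty with rfl | hJ
    · obtain ⟨e, t, s, -, -, hpos⟩ := h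
      refine ⟨0, 1, 1, fun _ => Nat.zero_le _, le_rfl, hbase, le_rfl, hbase, fun r hr => ?_⟩
      simpa using hpos r hr
    set X := Φ^[l] C with hXdef
    have hCX : C ≤ X := hCiter _ _
    obtain ⟨T, hTJ, hT, f, hf, p, q, hp, hpM, hq, hqM, hrow, hred⟩ :=
      -- The thresholds are `Θ k = Φ^[k] C`; only `k ≤ l` occur.
      h.exists_leading hα hβ hJ hJC hR (hiter C) (by simpa using (by omega : 1 ≤ C))
        (fun k => by
          simp only [Function.iterate_succ_apply']
          refine le_trans ?_ (hpow _ 7 (by norm_num))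
          have hk := hCiter C k
          calc 2 * C ^ 4 * (Φ^[k] C) ^ 2
              ≤ (Φ^[k] C + 2) * (Φ^[k] C + 2) ^ 4 * (Φ^[k] C + 2) ^ 2 := by gcongr <;> omega
            _ = (Φ^[k] C + 2) ^ 7 := by ring)
        (fun k hk => hiter C (by omega : k ≤ l))
    set M := C ^ 2 * X with hM
    set C' := Φ X with hC'
    have hMC : 2 * M * C ≤ C' := by
      refine le_trans ?_ (hpow X 5 (by norm_num))
      calc 2 * M * C = 2 * C ^ 2 * X * C := by rw [hM]; ring
        _ ≤ (X + 2) * (X + 2) ^ 2 * (X + 2) * (X + 2) := by gcongr <;> omega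
        _ = (X + 2) ^ 5 := by ring
    have hXC' : X ≤ C' := hΦle X
    have hcard : (J \ T).card ≤ l := by
      rw [Finset.card_sdiff_of_subset hTJ]
      have := Finset.card_pos.mpr hT
      omega
    have hIH := ih (J := J \ T) (C := C') hcard
      (((Finset.card_le_card Finset.sdiff_subset).trans hJC).trans (hCX.trans hXC')) (by omega)
      (by omega) (by omega)
      (fun v hv j => (abs_reducedRows_le hR v hv j).trans (by exact_mod_cast hMC)) hred
    set B' := Φ^[(l + 3) ^ 2] C' with hB'
    have hC'B' : C' ≤ B' := hCiter _ _
    have hMC' : M ≤ C' := le_trans (by nlinarith [Nat.zero_le M]) hMC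
    set V := Φ B' with hV
    have hB'V : B' ≤ V := hΦle _
    have hVbase : ∀ γ ≤ C, 2 * B' * (C * C * γ ^ B') ≤ V := by
      intro γ hγ
      refine le_trans ?_ (hgrow B')
      calc 2 * B' * (C * C * γ ^ B')
          ≤ (B' + 2) * (B' + 2) * ((B' + 2) * (B' + 2) * (B' + 2) ^ B') := by gcongr <;> omega
        _ = (B' + 2) ^ (B' + 4) := by ring
        _ ≤ (B' + 2) ^ (B' + 10) := Nat.pow_le_pow_right (by omega) (by omega)
    set b := Φ (Φ V) with hb
    have hVb : V ≤ b := (hΦle V).trans (hΦle _)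
    have hBbase : ∀ γ ≤ C, (V + 2) ^ 6 * γ ^ b ≤ Φ b := by
      intro γ hγ
      refine le_trans ?_ (hgrow b)
      calc (V + 2) ^ 6 * γ ^ b ≤ (b + 2) ^ 6 * (b + 2) ^ b := by (gcongr; omega)
        _ = (b + 2) ^ (b + 6) := by ring
        _ ≤ (b + 2) ^ (b + 10) := Nat.pow_le_pow_right (by omega) (by omega)
    have hglue := ExistsBoundedPoint.glue hα hβ hTJ hJC hR hf hp hpM hq hqM hrow hIH
      (by omega : M ≤ V) hB'V (hVbase α hαC) (hVbase β hβC) (hpow V 10 le_rfl) (hΦ (Φ V))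
      (B := Φ b) (by have := hpow b 2 (by norm_num); nlinarith) (by have := hΦle b; omega)
      (hBbase α hαC) (hBbase β hβC)
    refine hglue.mono ?_
    -- The step costs `l` iterates for `X`, then one for `C'`, one for `V`, two for `b` and one for
    -- the final bound, and `(l + 3) ^ 2 + (l + 5) ≤ (l + 4) ^ 2`.
    have : Φ b = Φ^[(l + 3) ^ 2 + (l + 5)] C := by
      rw [hb, hV, hB', hC', hXdef]
      simp only [← Function.iterate_succ_apply', ← Function.iterate_add_apply]
      congr 1
    rw [this]
    exact hiter C (by nlinarith)

/-! ### Approximation by quotients of powers -/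

theorem irrational_log_div_log {α β : ℕ} (hα : 1 < α) (hβ : 1 < β)
    (h : MultiplicativelyIndependent α β) : Irrational (Real.log α / Real.log β) := by
  have hlα : 0 < Real.log α := Real.log_pos (by exact_mod_cast hα)
  have hlβ : 0 < Real.log β := Real.log_pos (by exact_mod_cast hβ)
  rintro ⟨r, hr⟩
  have hr0 : 0 < r := by
    have : (0 : ℝ) < r := hr ▸ div_pos hlα hlβ
    exact_mod_cast this
  have hnum : 0 < r.num := Rat.num_pos.mpr hr0
  have hden : (0 : ℝ) < r.den := by exact_mod_cast r.den_pos
  have key : (r.den : ℝ) * Real.log α = r.num.toNat * Real.log β := by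
    have h2 : ((r.num.toNat : ℕ) : ℝ) = (r.num : ℝ) := by
      exact_mod_cast Int.toNat_of_nonneg hnum.le
    have h3 : (r : ℝ) = r.num / r.den := Rat.cast_def r
    rw [h3, div_eq_div_iff hden.ne' hlβ.ne'] at hr
    rw [h2, hr]
    ring
  rw [← Real.log_pow, ← Real.log_pow] at key
  have hpow : (α : ℝ) ^ r.den = (β : ℝ) ^ r.num.toNat :=
    Real.log_injOn_pos (Set.mem_Ioi.mpr (by positivity)) (Set.mem_Ioi.mpr (by positivity)) key
  have := h.2.2 r.den r.num.toNat (by exact_mod_cast hpow)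
  exact r.den_pos.ne' this.1

/-- If `a / b` is irrational, then the differences of large natural multiples of `a` and `b` are
dense. -/
theorem exists_nat_mul_sub_mul_near {a b : ℝ} (ha : 0 < a) (hb : 0 < b) (h : Irrational (a / b))
    (K : ℕ) (y : ℝ) {ε : ℝ} (hε : 0 < ε) :
    ∃ N m : ℕ, K ≤ N ∧ K ≤ m ∧ |N * a - m * b - y| < ε := by
  obtain ⟨g, hg, hgy⟩ := Metric.dense_iff.mp (dense_addSubgroupClosure_pair_iff.mpr h) y (ε / 2)
    (by positivity)
  obtain ⟨n₁, n₂, hn⟩ := AddSubgroup.mem_closure_pair.mp hgy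
  rw [Metric.mem_ball, Real.dist_eq, ← hn, zsmul_eq_mul, zsmul_eq_mul] at hg
  -- Density yields integer coefficients of arbitrary sign. Adding `J` copies of a Dirichlet pair
  -- `(k, j)` makes both large while moving the value by less than `ε / 2`.
  set J : ℕ := K + n₁.natAbs + n₂.natAbs + 1 with hJ
  have hJ0 : (0 : ℝ) < J := by positivity
  have hξ : 0 < a / b := div_pos ha hb
  -- The term `a / b` in the minimum forces `j > 0`.
  obtain ⟨n, hn⟩ := exists_nat_one_div_lt (lt_min hξ (by positivity : 0 < ε / (2 * b * J)))
  have hle : 1 / (((n + 1 : ℕ) : ℝ) + 1) ≤ 1 / ((n : ℝ) + 1) := by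
    apply one_div_le_one_div_of_le (by positivity)
    push_cast
    linarith
  obtain ⟨j, k, hk, -, hjk⟩ := Real.exists_int_int_abs_mul_sub_le (a / b) (Nat.succ_pos n)
  have hjk' := (hjk.trans hle).trans_lt hn
  have h1 := hjk'.trans_le (min_le_left _ _)
  have h2 := hjk'.trans_le (min_le_right _ _)
  have hk1 : (1 : ℝ) ≤ k := by exact_mod_cast hk
  have hj : 0 < j := by
    have h3 := (abs_lt.mp h1).2
    have : (0 : ℝ) < j := by nlinarith
    exact_mod_cast this
  have hN : (K : ℤ) ≤ J * k + n₁ := by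
    have : (J : ℤ) ≤ J * k := le_mul_of_one_le_right (by positivity) hk
    omega
  have hm : (K : ℤ) ≤ J * j - n₂ := by
    have : (J : ℤ) ≤ J * j := le_mul_of_one_le_right (by positivity) hj
    omega
  refine ⟨(J * k + n₁).toNat, (J * j - n₂).toNat, by omega, by omega, ?_⟩
  have e1 : (((J * k + n₁).toNat : ℕ) : ℝ) = J * k + n₁ := by
    exact_mod_cast Int.toNat_of_nonneg (by omega : 0 ≤ J * k + n₁)
  have e2 : (((J * j - n₂).toNat : ℕ) : ℝ) = J * j - n₂ := by
    exact_mod_cast Int.toNat_of_nonneg (by omega : 0 ≤ J * j - n₂)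
  have e3 : (J * k + n₁) * a - (J * j - n₂) * b - y =
      (n₁ * a + n₂ * b - y) + J * b * (k * (a / b) - j) := by
    field_simp
    ring
  have e4 : |J * b * (k * (a / b) - j)| < ε / 2 := by
    rw [abs_mul, abs_of_pos (by positivity : 0 < J * b)]
    calc J * b * |k * (a / b) - j| < J * b * (ε / (2 * b * J)) :=
          mul_lt_mul_of_pos_left h2 (by positivity)
      _ = ε / 2 := by field_simp
  rw [e1, e2, e3]
  calc _ ≤ _ := abs_add_le _ _
    _ < ε / 2 + ε / 2 := add_lt_add hg e4
    _ = ε := by ring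

theorem exists_pow_approximation {α β : ℕ} (hα : 1 < α) (hβ : 1 < β)
    (h : MultiplicativelyIndependent α β) {x P Q : ℕ} (hP : 0 < P) (hQ : 0 < Q) :
    ∃ N m : ℕ, x ≤ α ^ N ∧ x ≤ β ^ m ∧
      x * (P * α ^ N) < x * (Q * β ^ m) + β ^ m ∧ x * (Q * β ^ m) < x * (P * α ^ N) + β ^ m := by
  have hP' : (0 : ℝ) < P := by exact_mod_cast hP
  have hQ' : (0 : ℝ) < Q := by exact_mod_cast hQ
  have hα' : (0 : ℝ) < α := by exact_mod_cast (by omega : 0 < α)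
  have hβ' : (0 : ℝ) < β := by exact_mod_cast (by omega : 0 < β)
  -- Exponentiating turns closeness to `log (Q / P)` into closeness of `α ^ N / β ^ m` to `Q / P`.
  -- The tolerance uses `x + 1` so that `x = 0` is allowed.
  obtain ⟨ε, hε, hcont⟩ := Metric.continuous_iff.mp Real.continuous_exp (Real.log (Q / P))
    (1 / ((x + 1) * P)) (by positivity)
  obtain ⟨N, m, hN, hm, hNm⟩ := exists_nat_mul_sub_mul_near
    (Real.log_pos (by exact_mod_cast hα)) (Real.log_pos (by exact_mod_cast hβ))
    (irrational_log_div_log hα hβ h) x (Real.log (Q / P)) hε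
  have key := hcont (N * Real.log α - m * Real.log β) (by rwa [Real.dist_eq])
  rw [Real.dist_eq, Real.exp_log (by positivity), Real.exp_sub, ← Real.log_pow, ← Real.log_pow,
    Real.exp_log (by positivity), Real.exp_log (by positivity)] at key
  have hx : (0 : ℝ) < x + 1 := by positivity
  have hβm : (0 : ℝ) < (β : ℝ) ^ m := by positivity
  have key2 : |(x + 1) * (P * (α : ℝ) ^ N - Q * (β : ℝ) ^ m)| < (β : ℝ) ^ m := by
    have e1 : (x + 1) * (P * (α : ℝ) ^ N - Q * (β : ℝ) ^ m) =
        ((x + 1) * P * (β : ℝ) ^ m) * ((α : ℝ) ^ N / (β : ℝ) ^ m - Q / P) := by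
      field_simp
    rw [e1, abs_mul, abs_of_pos (by positivity)]
    calc _ < ((x + 1) * P * (β : ℝ) ^ m) * (1 / ((x + 1) * P)) :=
          mul_lt_mul_of_pos_left key (by positivity)
      _ = (β : ℝ) ^ m := by field_simp
  have key3 : |x * (P * (α : ℝ) ^ N - Q * (β : ℝ) ^ m)| < (β : ℝ) ^ m := by
    refine lt_of_le_of_lt ?_ key2
    rw [abs_mul, abs_mul, abs_of_pos hx, abs_of_nonneg (by positivity : (0 : ℝ) ≤ x)]
    exact mul_le_mul_of_nonneg_right (by linarith) (abs_nonneg _)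
  obtain ⟨k1, k2⟩ := abs_lt.mp key3
  refine ⟨N, m, hN.trans (Nat.lt_pow_self hα).le, hm.trans (Nat.lt_pow_self hβ).le, ?_, ?_⟩
  · have : (x : ℝ) * (P * (α : ℝ) ^ N) < x * (Q * (β : ℝ) ^ m) + (β : ℝ) ^ m := by linarith
    exact_mod_cast this
  · have : (x : ℝ) * (Q * (β : ℝ) ^ m) < x * (P * (α : ℝ) ^ N) + (β : ℝ) ^ m := by linarith
    exact_mod_cast this

theorem exists_hasApproximation {α β : ℕ} (hα : 1 < α) (hβ : 1 < β)
    (h : MultiplicativelyIndependent α β) (x : ℕ) : ∃ b, HasApproximation α β x b := by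
  have key : ∀ᶠ b in Filter.atTop, ∀ P ∈ Finset.range x, ∀ Q ∈ Finset.range x, 0 < P → 0 < Q →
      ∃ N < b, ∃ m < b, x ≤ α ^ N ∧ x ≤ β ^ m ∧
        x * (P * α ^ N) < x * (Q * β ^ m) + β ^ m ∧
        x * (Q * β ^ m) < x * (P * α ^ N) + β ^ m := by
    rw [Filter.eventually_all_finset]
    intro P _
    rw [Filter.eventually_all_finset]
    intro Q _
    by_cases hPQ : 0 < P ∧ 0 < Q
    · obtain ⟨N, m, hNm⟩ := exists_pow_approximation hα hβ h (x := x) hPQ.1 hPQ.2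
      filter_upwards [Filter.eventually_gt_atTop N, Filter.eventually_gt_atTop m] with b hN hm _ _
      exact ⟨N, hN, m, hm, hNm⟩
    · exact Filter.Eventually.of_forall fun b hP hQ => absurd ⟨hP, hQ⟩ hPQ
  obtain ⟨b, hb⟩ := key.exists
  exact ⟨b, fun P hP Q hQ => hb P (Finset.mem_range.mpr hP) Q (Finset.mem_range.mpr hQ)⟩

/-! ### From scaled powers to actual powers -/

/-- A bounded solution with scales gives a solution in actual powers. -/
theorem ExistsBoundedPoint.exists_pow {α β : ℕ} (hα : 1 < α) {ι : Type*}
    {c : ι → Bool} {J : Finset ι} {R : Set (ι → ℤ)} {B C x b : ℕ} (hJC : J.card ≤ C)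
    (hR : ∀ r ∈ R, ∀ j, |r j| ≤ C) (h : ExistsBoundedPoint α β c J R B)
    (hx : C * C * α ^ B < x) (hBx : B < x) (happ : HasApproximation α β x b) :
    ∃ n : ι → ℕ, (∀ j, n j ≤ B + b) ∧
      ∀ r ∈ R, 0 < ∑ j ∈ J, r j * (((if c j then α else β : ℕ) : ℤ)) ^ n j := by
  obtain ⟨e, t, s, he, ht, htB, hs, hsB, hpos⟩ := h
  obtain ⟨N, hN, m, hm, -, hxm, h1, h2⟩ := happ s (hsB.trans_lt hBx) t (htB.trans_lt hBx) hs ht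
  refine ⟨fun j => if c j then e j + N else e j + m, fun j => ?_, fun r hr => ?_⟩
  · have := he j
    simp only
    split_ifs <;> omega
  · set y := expSum α {j ∈ J | c j} e r with hy
    set u := expSum β {j ∈ J | ¬ c j} e r with hu
    have hrow : 1 ≤ t * y + s * u := by
      have := hpos r hr
      rw [sum_mul_ite_scaled] at this
      exact this
    have hyx : |y| < x := by
      refine lt_of_le_of_lt (abs_expSum_le (n := C) (C := C) (E := α ^ B)
        ((Finset.card_le_card (Finset.filter_subset _ _)).trans hJC) (fun j _ => hR r hr j)
        fun j _ => Nat.pow_le_pow_right (by omega) (he j)) ?_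
      exact_mod_cast hx
    have hsum : ∑ j ∈ J, r j * (((if c j then α else β : ℕ) : ℤ)) ^
        (if c j then e j + N else e j + m) = (α : ℤ) ^ N * y + (β : ℤ) ^ m * u := by
      rw [hy, hu, expSum, expSum, ← sum_mul_ite_scaled]
      refine Finset.sum_congr rfl fun j _ => ?_
      split_ifs <;> ring
    rw [hsum]
    have h1' : (x : ℤ) * (s * (α : ℤ) ^ N) < x * (t * (β : ℤ) ^ m) + (β : ℤ) ^ m := by
      exact_mod_cast h1
    have h2' : (x : ℤ) * (t * (β : ℤ) ^ m) < x * (s * (α : ℤ) ^ N) + (β : ℤ) ^ m := by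
      exact_mod_cast h2
    have hx0 : (0 : ℤ) < x := by exact_mod_cast (Nat.zero_le B).trans_lt hBx
    set Z : ℤ := s * (α : ℤ) ^ N - t * (β : ℤ) ^ m with hZ
    have hZx : |Z| * x < (β : ℤ) ^ m := by
      have e1 : Z * x = x * (s * (α : ℤ) ^ N) - x * (t * (β : ℤ) ^ m) := by rw [hZ]; ring
      have e2 : |Z * x| < (β : ℤ) ^ m := by
        rw [abs_lt, e1]
        constructor <;> linarith
      rwa [abs_mul, abs_of_pos hx0] at e2
    have hZy : -(β : ℤ) ^ m < Z * y := by
      have e1 : |Z * y| ≤ |Z| * x := by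
        rw [abs_mul]
        exact mul_le_mul_of_nonneg_left hyx.le (abs_nonneg _)
      have := neg_abs_le (Z * y)
      linarith
    have hs0 : (0 : ℤ) < s := by exact_mod_cast hs
    refine pos_of_mul_pos_right (a := (s : ℤ)) ?_ hs0.le
    -- Multiplied by `s`, the row is `β ^ m` times the positive integer `t * y + s * u`, plus an
    -- error below `β ^ m`.
    have e3 : (s : ℤ) * ((α : ℤ) ^ N * y + (β : ℤ) ^ m * u) =
        (β : ℤ) ^ m * (t * y + s * u) + Z * y := by
      rw [hZ]
      ring
    have hβ0 : (0 : ℤ) ≤ (β : ℤ) ^ m := by positivity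
    have := mul_le_mul_of_nonneg_left hrow hβ0
    rw [e3]
    linarith

/-- Solvability of the inequality problem is equivalent to solvability with bounded exponents. -/
theorem pureIneqSolvable_iff_exists_le {α β : ℕ} (hα : 1 < α) (hβ : 1 < β) {Φ : ℕ → ℕ}
    (hΦ : ∀ x, HasApproximation α β x (Φ x)) (hgrow : ∀ x, (x + 2) ^ (x + 10) ≤ Φ x)
    {l r C : ℕ} {z : Fin l → ℕ} (hz : ∀ j, z j = α ∨ z j = β) {A : Matrix (Fin r) (Fin l) ℤ}
    (hlC : l ≤ C) (hC : 2 ≤ C) (hαC : α ≤ C) (hβC : β ≤ C) (hA : ∀ i j, |A i j| ≤ C) :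
    PureIneqSolvable z A ↔ ∃ n : Fin l → ℕ, (∀ j, n j ≤ Φ^[(l + 3) ^ 2 + 3] C) ∧
      ∀ i, 0 < ∑ j, A i j * (z j : ℤ) ^ n j := by
  constructor
  · rintro ⟨n, hn⟩
    set c : Fin l → Bool := fun j => decide (z j = α) with hc
    have hzc : ∀ j, z j = if c j then α else β := by
      intro j
      rcases hz j with h | h
      · simp [hc, h]
      · by_cases hαβ : z j = α
        · simp [hc, hαβ]
        · simp [hc, h ▸ hαβ, h]
    have hreal : ExistsRealPoint α β c Finset.univ (Set.range A) := by
      refine ⟨fun j => n j, 1, 1, one_pos, one_pos, ?_⟩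
      rintro _ ⟨i, rfl⟩
      have h1 := hn i
      simp only [Matrix.mulVec, dotProduct] at h1
      have h2 : (0 : ℝ) < ((∑ j, A i j * (z j : ℤ) ^ n j : ℤ) : ℝ) := by exact_mod_cast h1
      refine h2.trans_eq ?_
      push_cast
      refine Finset.sum_congr rfl fun j _ => ?_
      rw [hzc j]
      split_ifs <;> simp
    have hR : ∀ v ∈ Set.range A, ∀ j, |v j| ≤ C := by
      rintro _ ⟨i, rfl⟩ j
      exact hA i j
    have hcard : (Finset.univ : Finset (Fin l)).card = l := by simp
    have hbdd := hreal.existsBoundedPoint hα hβ hΦ hgrow l hcard.le (hcard.le.trans hlC) hC hαC hβC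
      hR
    set B := Φ^[(l + 3) ^ 2] C with hB
    have hpow : ∀ x k, k ≤ x + 10 → (x + 2) ^ k ≤ Φ x := fun x k hk =>
      (Nat.pow_le_pow_right (by omega) hk).trans (hgrow x)
    have hΦlt : ∀ x, x < Φ x := fun x => by
      have := hpow x 1 (by omega)
      rw [pow_one] at this
      omega
    have hCB : C ≤ B := by
      have : ∀ k, C ≤ Φ^[k] C := by
        intro k
        induction k with
        | zero => exact le_rfl
        | succ k ih =>
          rw [Function.iterate_succ_apply']
          exact ih.trans (hΦlt _).le
      exact this _
    obtain ⟨N, hN, hNpos⟩ := hbdd.exists_pow hα (hcard.le.trans hlC) hR (x := Φ B)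
      (by
        refine lt_of_lt_of_le ?_ (hpow B (B + 3) (by omega))
        calc C * C * α ^ B ≤ (B + 2) * (B + 2) * (B + 2) ^ B := by gcongr <;> omega
          _ = (B + 2) ^ (B + 2) := by ring
          _ < (B + 2) ^ (B + 3) := Nat.pow_lt_pow_right (by omega) (by omega))
      (hΦlt B) (hΦ (Φ B))
    refine ⟨N, fun j => (hN j).trans ?_, fun i => ?_⟩
    -- The three further iterates give the precision `Φ B`, the approximation exponents `Φ (Φ B)`,
    -- and room for the sum `B + Φ (Φ B)`.
    · rw [add_comm ((l + 3) ^ 2), Function.iterate_add_apply, ← hB]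
      change B + Φ (Φ B) ≤ Φ (Φ (Φ B))
      have h1 := hΦlt B
      have h2 := hΦlt (Φ B)
      have h3 := hpow (Φ (Φ B)) 2 (by omega)
      nlinarith
    · refine (hNpos _ ⟨i, rfl⟩).trans_eq (Finset.sum_congr rfl fun j _ => ?_)
      rw [hzc j]
  · rintro ⟨n, -, hn⟩
    exact ⟨n, hn⟩

/-! ### Primitive recursive ingredients -/

theorem Primrec.nat_pow : Primrec₂ ((· ^ ·) : ℕ → ℕ → ℕ) :=
  Primrec₂.unpaired'.1 Nat.Primrec.pow

theorem Primrec.finset_sum_range {α : Type*} [Primcodable α] {f : α → ℕ} {g : α → ℕ → ℕ}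
    (hf : Primrec f) (hg : Primrec₂ g) : Primrec fun a => ∑ j ∈ Finset.range (f a), g a j := by
  refine (Primrec.nat_rec' (h := fun a p => p.2 + g a p.1) hf (Primrec.const 0)
    (Primrec.nat_add.comp (Primrec.snd.comp Primrec.snd)
      (hg.comp Primrec.fst (Primrec.fst.comp Primrec.snd)))).of_eq fun a => ?_
  induction f a with
  | zero => rfl
  | succ n ih => rw [Finset.sum_range_succ, ← ih]

/-- The parity of the code is the sign, so positive and negative parts of an integer are obtained by
arithmetic on its code. -/
theorem Int.encode_eq (a : ℤ) :
    Encodable.encode a = if 0 ≤ a then 2 * a.toNat else 2 * ((-a).toNat - 1) + 1 := by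
  cases a with
  | ofNat n =>
    change 2 * n = _
    simp
  | negSucc n =>
    change 2 * n + 1 = _
    simp

theorem Primrec.int_toNat : Primrec Int.toNat := by
  refine (Primrec.ite (c := fun a : ℤ => Encodable.encode a % 2 = 0)
    (Primrec.eq.comp (Primrec.nat_mod.comp Primrec.encode (Primrec.const 2)) (Primrec.const 0))
    (Primrec.nat_div.comp Primrec.encode (Primrec.const 2)) (Primrec.const 0)).of_eq fun a => ?_
  rw [Int.encode_eq]
  split_ifs <;> omega

theorem Primrec.int_neg_toNat : Primrec fun a : ℤ => (-a).toNat := by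
  refine (Primrec.ite (c := fun a : ℤ => Encodable.encode a % 2 = 0)
    (Primrec.eq.comp (Primrec.nat_mod.comp Primrec.encode (Primrec.const 2)) (Primrec.const 0))
    (Primrec.const 0)
    (Primrec.succ.comp (Primrec.nat_div.comp Primrec.encode (Primrec.const 2)))).of_eq fun a => ?_
  rw [Int.encode_eq]
  split_ifs <;> omega

theorem PrimrecPred.exists_lt_of {α : Type*} [Primcodable α] {f : α → ℕ} {R : ℕ → α → Prop}
    (hf : Primrec f) (hR : PrimrecPred fun p : ℕ × α => R p.1 p.2) :
    PrimrecPred fun a => ∃ n < f a, R n a :=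
  (PrimrecRel.comp (PrimrecRel.exists_mem_list (R := R) hR) (Primrec.list_range.comp hf)
    Primrec.id).of_eq fun a => by simp

theorem PrimrecPred.forall_lt_of {α : Type*} [Primcodable α] {f : α → ℕ} {R : ℕ → α → Prop}
    (hf : Primrec f) (hR : PrimrecPred fun p : ℕ × α => R p.1 p.2) :
    PrimrecPred fun a => ∀ n < f a, R n a :=
  (PrimrecRel.comp (PrimrecRel.forall_mem_list (R := R) hR) (Primrec.list_range.comp hf)
    Primrec.id).of_eq fun a => by simp

theorem PrimrecPred.imp {α : Type*} [Primcodable α] {p q : α → Prop} (hp : PrimrecPred p)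
    (hq : PrimrecPred q) : PrimrecPred fun a => p a → q a :=
  (hp.not.or hq).of_eq fun _ => imp_iff_not_or.symm

theorem primrecPred_hasApproximation : PrimrecPred fun y : (ℕ × ℕ × ℕ) × ℕ =>
    HasApproximation y.1.1 y.1.2.1 y.1.2.2 y.2 := by
  have hα : Primrec fun y : (ℕ × ℕ × ℕ) × ℕ => y.1.1 := Primrec.fst.comp Primrec.fst
  have hβ : Primrec fun y : (ℕ × ℕ × ℕ) × ℕ => y.1.2.1 :=
    Primrec.fst.comp (Primrec.snd.comp Primrec.fst)
  have hx : Primrec fun y : (ℕ × ℕ × ℕ) × ℕ => y.1.2.2 :=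
    Primrec.snd.comp (Primrec.snd.comp Primrec.fst)
  have hb : Primrec fun y : (ℕ × ℕ × ℕ) × ℕ => y.2 := Primrec.snd
  have hP : Primrec fun p : ℕ × (ℕ × ℕ × ℕ) × ℕ => p.1 := Primrec.fst
  refine PrimrecPred.forall_lt_of hx (PrimrecPred.forall_lt_of (hx.comp Primrec.snd)
    (PrimrecPred.imp (Primrec.nat_lt.comp (Primrec.const 0) (hP.comp Primrec.snd))
    (PrimrecPred.imp (Primrec.nat_lt.comp (Primrec.const 0) Primrec.fst)
    (PrimrecPred.exists_lt_of (hb.comp (Primrec.snd.comp Primrec.snd))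
    (PrimrecPred.exists_lt_of
      (hb.comp (Primrec.snd.comp (Primrec.snd.comp Primrec.snd))) ?_)))))
  have hy : Primrec fun v : ℕ × ℕ × ℕ × ℕ × (ℕ × ℕ × ℕ) × ℕ => v.2.2.2.2 :=
    Primrec.snd.comp (Primrec.snd.comp (Primrec.snd.comp Primrec.snd))
  have hP' : Primrec fun v : ℕ × ℕ × ℕ × ℕ × (ℕ × ℕ × ℕ) × ℕ => v.2.2.2.1 :=
    Primrec.fst.comp (Primrec.snd.comp (Primrec.snd.comp Primrec.snd))
  have hQ' : Primrec fun v : ℕ × ℕ × ℕ × ℕ × (ℕ × ℕ × ℕ) × ℕ => v.2.2.1 :=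
    Primrec.fst.comp (Primrec.snd.comp Primrec.snd)
  have hN' : Primrec fun v : ℕ × ℕ × ℕ × ℕ × (ℕ × ℕ × ℕ) × ℕ => v.2.1 :=
    Primrec.fst.comp Primrec.snd
  have hA := Primrec.nat_pow.comp (hα.comp hy) hN'
  have hB := Primrec.nat_pow.comp (hβ.comp hy) Primrec.fst
  have hPA := Primrec.nat_mul.comp (hx.comp hy) (Primrec.nat_mul.comp hP' hA)
  have hQB := Primrec.nat_mul.comp (hx.comp hy) (Primrec.nat_mul.comp hQ' hB)
  exact (Primrec.nat_le.comp (hx.comp hy) hA).and ((Primrec.nat_le.comp (hx.comp hy) hB).and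
    ((Primrec.nat_lt.comp hPA (Primrec.nat_add.comp hQB hB)).and
      (Primrec.nat_lt.comp hQB (Primrec.nat_add.comp hPA hB))))

/-! ### Computing the approximation bound -/

/-- Either `b` bounds the exponents of the approximations, or it bounds the size of a certificate
that `α, β` are not multiplicatively independent integers above `1`. -/
def ApproximationOrDependence (y : ℕ × ℕ × ℕ) (b : ℕ) : Prop :=
  y.1 ≤ 1 ∨ y.2.1 ≤ 1 ∨ (∃ m < b, ∃ n < b, (0 < m ∨ 0 < n) ∧ y.1 ^ m = y.2.1 ^ n) ∨
    HasApproximation y.1 y.2.1 y.2.2 b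

theorem primrecPred_approximationOrDependence :
    PrimrecPred fun v : (ℕ × ℕ × ℕ) × ℕ => ApproximationOrDependence v.1 v.2 := by
  have hα : Primrec fun y : (ℕ × ℕ × ℕ) × ℕ => y.1.1 := Primrec.fst.comp Primrec.fst
  have hβ : Primrec fun y : (ℕ × ℕ × ℕ) × ℕ => y.1.2.1 :=
    Primrec.fst.comp (Primrec.snd.comp Primrec.fst)
  refine (Primrec.nat_le.comp hα (Primrec.const 1)).or
    ((Primrec.nat_le.comp hβ (Primrec.const 1)).or
    (PrimrecPred.or ?_ primrecPred_hasApproximation))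
  refine PrimrecPred.exists_lt_of Primrec.snd
    (PrimrecPred.exists_lt_of (Primrec.snd.comp Primrec.snd) ?_)
  have hm : Primrec fun v : ℕ × ℕ × (ℕ × ℕ × ℕ) × ℕ => v.2.1 := Primrec.fst.comp Primrec.snd
  have hy : Primrec fun v : ℕ × ℕ × (ℕ × ℕ × ℕ) × ℕ => v.2.2 := Primrec.snd.comp Primrec.snd
  exact ((Primrec.nat_lt.comp (Primrec.const 0) hm).or
    (Primrec.nat_lt.comp (Primrec.const 0) Primrec.fst)).and
    (Primrec.eq.comp (Primrec.nat_pow.comp (hα.comp hy) hm)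
      (Primrec.nat_pow.comp (hβ.comp hy) Primrec.fst))

theorem exists_approximationOrDependence (y : ℕ × ℕ × ℕ) : ∃ b, ApproximationOrDependence y b := by
  by_cases hα : y.1 ≤ 1
  · exact ⟨0, Or.inl hα⟩
  by_cases hβ : y.2.1 ≤ 1
  · exact ⟨0, Or.inr (Or.inl hβ)⟩
  by_cases h : MultiplicativelyIndependent y.1 y.2.1
  · obtain ⟨b, hb⟩ := exists_hasApproximation (by omega) (by omega) h y.2.2
    exact ⟨b, Or.inr (Or.inr (Or.inr hb))⟩
  · have : ∃ m n : ℕ, y.1 ^ m = y.2.1 ^ n ∧ ¬ (m = 0 ∧ n = 0) := by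
      by_contra! hne
      exact h ⟨by omega, by omega, fun m n hmn => hne m n hmn⟩
    obtain ⟨m, n, hmn, h0⟩ := this
    exact ⟨m + n + 1, Or.inr (Or.inr (Or.inl ⟨m, by omega, n, by omega, by omega, hmn⟩))⟩

/-- The function is an unbounded search for `b`. The escape clauses of `ApproximationOrDependence`
make it halt on every input, hence total; for independent bases above 1 they cannot hold, so the
value found bounds approximations. -/
theorem exists_computable_approximation : ∃ f : ℕ × ℕ × ℕ → ℕ, Computable f ∧
    ∀ α β x, 1 < α → 1 < β → MultiplicativelyIndependent α β →
      HasApproximation α β x (f (α, β, x)) := by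
  classical
  have hp : Computable₂ fun (y : ℕ × ℕ × ℕ) (b : ℕ) => decide (ApproximationOrDependence y b) :=
    primrecPred_approximationOrDependence.decide.to_comp
  have hr := Partrec.rfind hp.partrec₂
  have hdom : ∀ y : ℕ × ℕ × ℕ,
      (Nat.rfind fun b => Part.some (decide (ApproximationOrDependence y b))).Dom := by
    intro y
    obtain ⟨b, hb⟩ := exists_approximationOrDependence y
    exact Nat.rfind_dom'.mpr ⟨b, by simpa using hb, fun _ => trivial⟩
  refine ⟨fun y => (Nat.rfind fun b => Part.some (decide (ApproximationOrDependence y b))).get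
    (hdom y), hr.of_eq_tot fun y => Part.get_mem _, fun α β x hα hβ h => ?_⟩
  have hspec := Nat.rfind_spec (Part.get_mem (hdom (α, β, x)))
  rw [Part.mem_some_iff] at hspec
  rcases of_decide_eq_true hspec.symm with h1 | h1 | ⟨m, -, n, -, hmn, heq⟩ | h1
  · exact absurd h1 (by simpa using hα)
  · exact absurd h1 (by simpa using hβ)
  · have := h.2.2 m n heq
    omega
  · exact h1

theorem HasApproximation.mono {α β x b b' : ℕ} (h : HasApproximation α β x b) (hb : b ≤ b') :
    HasApproximation α β x b' := by
  intro P hPx Q hQx hP hQ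
  obtain ⟨N, hN, m, hm, hNm⟩ := h P hPx Q hQx hP hQ
  exact ⟨N, hN.trans_le hb, m, hm.trans_le hb, hNm⟩

theorem Computable.nat_iterate {α σ : Type*} [Primcodable α] [Primcodable σ] {f : α → ℕ} {g : α → σ}
    {h : α → σ → σ} (hf : Computable f) (hg : Computable g) (hh : Computable₂ h) :
    Computable fun a => (h a)^[f a] (g a) := by
  refine (Computable.nat_rec (h := fun a p => h a p.2) hf hg
    (hh.comp Computable.fst (Computable.snd.comp Computable.snd)).to₂).of_eq fun a => ?_
  induction f a with
  | zero => rfl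
  | succ n ih => rw [Function.iterate_succ_apply', ← ih]

/-! ### The bounded search on encoded inputs -/

/-- The sum of a list of integers weighted by `g`, times powers of the bases `zs`, with exponents
the digits of `d` in base `B + 1`. -/
def digitPowSum (g : ℤ → ℕ) (zs : List ℕ) (B d : ℕ) (row : List ℤ) : ℕ :=
  ∑ j ∈ Finset.range zs.length, g (row.getD j 0) * zs.getD j 0 ^ (d / (B + 1) ^ j % (B + 1))

/-- The inequality problem presented by `x` has a solution with exponents at most `B`. -/
def BoundedlySolvable (x : PureIneqInput) (B : ℕ) : Prop :=
  ∃ d < (B + 1) ^ x.2.2.1.length, ∀ row ∈ x.2.2.2,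
    digitPowSum (fun a => (-a).toNat) x.2.2.1 B d row < digitPowSum Int.toNat x.2.2.1 B d row

theorem primrec_digitPowSum {g : ℤ → ℕ} (hg : Primrec g) :
    Primrec fun v : List ℕ × ℕ × ℕ × List ℤ => digitPowSum g v.1 v.2.1 v.2.2.1 v.2.2.2 := by
  refine Primrec.finset_sum_range (Primrec.list_length.comp Primrec.fst) ?_
  have hz : Primrec fun p : (List ℕ × ℕ × ℕ × List ℤ) × ℕ => p.1.1 := Primrec.fst.comp Primrec.fst
  have hB : Primrec fun p : (List ℕ × ℕ × ℕ × List ℤ) × ℕ => p.1.2.1 + 1 :=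
    Primrec.succ.comp (Primrec.fst.comp (Primrec.snd.comp Primrec.fst))
  have hd : Primrec fun p : (List ℕ × ℕ × ℕ × List ℤ) × ℕ => p.1.2.2.1 :=
    Primrec.fst.comp (Primrec.snd.comp (Primrec.snd.comp Primrec.fst))
  have hrow : Primrec fun p : (List ℕ × ℕ × ℕ × List ℤ) × ℕ => p.1.2.2.2 :=
    Primrec.snd.comp (Primrec.snd.comp (Primrec.snd.comp Primrec.fst))
  exact Primrec.nat_mul.comp (hg.comp ((Primrec.list_getD 0).comp hrow Primrec.snd))
    (Primrec.nat_pow.comp ((Primrec.list_getD 0).comp hz Primrec.snd)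
      (Primrec.nat_mod.comp (Primrec.nat_div.comp hd (Primrec.nat_pow.comp hB Primrec.snd)) hB))

theorem primrecPred_boundedlySolvable :
    PrimrecPred fun p : PureIneqInput × ℕ => BoundedlySolvable p.1 p.2 := by
  have hz : Primrec fun p : PureIneqInput × ℕ => p.1.2.2.1 :=
    Primrec.fst.comp (Primrec.snd.comp (Primrec.snd.comp Primrec.fst))
  have hrows : Primrec fun p : PureIneqInput × ℕ => p.1.2.2.2 :=
    Primrec.snd.comp (Primrec.snd.comp (Primrec.snd.comp Primrec.fst))
  refine PrimrecPred.exists_lt_of (Primrec.nat_pow.comp (Primrec.succ.comp Primrec.snd)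
    (Primrec.list_length.comp hz)) ?_
  have harg : Primrec fun v : List ℤ × ℕ × PureIneqInput × ℕ =>
      (v.2.2.1.2.2.1, v.2.2.2, v.2.1, v.1) :=
    (hz.comp (Primrec.snd.comp Primrec.snd)).pair
      ((Primrec.snd.comp (Primrec.snd.comp Primrec.snd)).pair
        ((Primrec.fst.comp Primrec.snd).pair Primrec.fst))
  have hR : PrimrecRel fun (row : List ℤ) (q : ℕ × PureIneqInput × ℕ) =>
      digitPowSum (fun a => (-a).toNat) q.2.1.2.2.1 q.2.2 q.1 row <
        digitPowSum Int.toNat q.2.1.2.2.1 q.2.2 q.1 row :=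
    Primrec.nat_lt.comp ((primrec_digitPowSum Primrec.int_neg_toNat).comp harg)
      ((primrec_digitPowSum Primrec.int_toNat).comp harg)
  exact PrimrecRel.comp hR.forall_mem_list (hrows.comp Primrec.snd) Primrec.id

/-- Numbers below `(B + 1) ^ l` correspond to exponent vectors with entries at most `B` through
their digits. Splitting each coefficient into positive and negative parts turns positivity over `ℤ`
into a comparison over `ℕ`. -/
theorem boundedlySolvable_iff {l r : ℕ} (α β : ℕ) (z : Fin l → ℕ) (A : Matrix (Fin r) (Fin l) ℤ)
    (B : ℕ) : BoundedlySolvable (pureIneqInput α β z A) B ↔ ∃ n : Fin l → ℕ, (∀ j, n j ≤ B) ∧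
      ∀ i, 0 < ∑ j, A i j * (z j : ℤ) ^ n j := by
  have key : ∀ (n : Fin l → ℕ) (d : ℕ), (∀ j : Fin l, d / (B + 1) ^ (j : ℕ) % (B + 1) = n j) →
      ∀ i, (digitPowSum (fun a => (-a).toNat) (List.ofFn z) B d (List.ofFn (A i)) <
        digitPowSum Int.toNat (List.ofFn z) B d (List.ofFn (A i)) ↔
          0 < ∑ j, A i j * (z j : ℤ) ^ n j) := by
    intro n d hd i
    have hsum : ∀ g : ℤ → ℕ, digitPowSum g (List.ofFn z) B d (List.ofFn (A i)) =
        ∑ j, g (A i j) * z j ^ n j := by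
      intro g
      rw [digitPowSum, List.length_ofFn, Finset.sum_range]
      refine Finset.sum_congr rfl fun j _ => ?_
      rw [hd j, List.getD_eq_getElem _ _ (by simp), List.getD_eq_getElem _ _ (by simp)]
      simp
    rw [hsum, hsum, ← Nat.cast_lt (α := ℤ), ← sub_pos]
    push_cast
    rw [← Finset.sum_sub_distrib]
    refine iff_of_eq (congrArg _ (Finset.sum_congr rfl fun j _ => ?_))
    rw [← sub_mul]
    congr 1
    omega
  simp only [BoundedlySolvable, pureIneqInput, List.length_ofFn, List.forall_mem_ofFn_iff]
  constructor
  · rintro ⟨d, -, hd⟩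
    exact ⟨fun j => d / (B + 1) ^ (j : ℕ) % (B + 1),
      fun j => Nat.lt_succ_iff.mp (Nat.mod_lt _ (Nat.succ_pos B)),
      fun i => (key _ d (fun _ => rfl) i).mp (hd i)⟩
  · rintro ⟨n, hn, hpos⟩
    set d := finFunctionFinEquiv (fun j => (⟨n j, Nat.lt_succ_iff.mpr (hn j)⟩ : Fin (B + 1))) with hd
    refine ⟨d, d.2, fun i => (key n d (fun j => ?_) i).mpr (hpos i)⟩
    have := finFunctionFinEquiv_symm_apply_val d j
    rw [← this, hd, Equiv.symm_apply_apply]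

/-- A bound for all the numbers that occur in an input. -/
def inputSize (x : PureIneqInput) : ℕ :=
  -- The bases in the list need no term, being `α` or `β` on valid inputs; the final 2 secures the
  -- requirement `2 ≤ C`.
  x.1 + x.2.1 + x.2.2.1.length + (x.2.2.2.flatten.map fun a => a.toNat + (-a).toNat).sum + 2

theorem primrec_inputSize : Primrec inputSize := by
  have hβ : Primrec fun x : PureIneqInput => x.2.1 := Primrec.fst.comp Primrec.snd
  have hz : Primrec fun x : PureIneqInput => x.2.2.1 :=
    Primrec.fst.comp (Primrec.snd.comp Primrec.snd)
  have hrows : Primrec fun x : PureIneqInput => x.2.2.2 :=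
    Primrec.snd.comp (Primrec.snd.comp Primrec.snd)
  have habs : Primrec fun a : ℤ => a.toNat + (-a).toNat :=
    Primrec.nat_add.comp Primrec.int_toNat Primrec.int_neg_toNat
  have hmap : Primrec fun x : PureIneqInput =>
      x.2.2.2.flatten.map fun a => a.toNat + (-a).toNat :=
    Primrec.list_map (Primrec.list_flatten.comp hrows) (habs.comp Primrec.snd).to₂
  have hsum : Primrec fun x : PureIneqInput =>
      (x.2.2.2.flatten.map fun a => a.toNat + (-a).toNat).sum :=
    Primrec.list_foldr (h := fun _ p => p.1 + p.2) hmap (Primrec.const 0)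
      (Primrec.nat_add.comp (Primrec.fst.comp Primrec.snd) (Primrec.snd.comp Primrec.snd)).to₂
  exact Primrec.nat_add.comp (Primrec.nat_add.comp (Primrec.nat_add.comp
    (Primrec.nat_add.comp Primrec.fst hβ) (Primrec.list_length.comp hz)) hsum) (Primrec.const 2)

theorem abs_le_inputSize {l r : ℕ} (α β : ℕ) (z : Fin l → ℕ) (A : Matrix (Fin r) (Fin l) ℤ)
    (i : Fin r) (j : Fin l) : |A i j| ≤ inputSize (pureIneqInput α β z A) := by
  have hmem : A i j ∈ (List.ofFn fun i => List.ofFn (A i)).flatten :=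
    List.mem_flatten.mpr ⟨_, List.mem_ofFn.mpr ⟨i, rfl⟩, List.mem_ofFn.mpr ⟨j, rfl⟩⟩
  have hsum : ∀ L : List ℤ, ∀ a ∈ L, a.natAbs ≤ (L.map fun a => a.toNat + (-a).toNat).sum := by
    intro L a ha
    have := List.single_le_sum (fun _ _ => Nat.zero_le _) _
      (List.mem_map_of_mem (f := fun a : ℤ => a.toNat + (-a).toNat) ha)
    omega
  rw [Int.abs_eq_natAbs, Nat.cast_le]
  exact (hsum _ _ hmem).trans ((Nat.le_add_left _ _).trans (Nat.le_add_right _ 2))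

/-- A fast growing function that dominates `f` at the bases of the input. -/
def growth (f : ℕ × ℕ × ℕ → ℕ) (x : PureIneqInput) (y : ℕ) : ℕ :=
  (y + 2) ^ (y + 10) + f (x.1, x.2.1, y)

theorem computable_growth {f : ℕ × ℕ × ℕ → ℕ} (hf : Computable f) : Computable₂ (growth f) := by
  have hpow : Primrec fun p : PureIneqInput × ℕ => (p.2 + 2) ^ (p.2 + 10) :=
    Primrec.nat_pow.comp (Primrec.nat_add.comp Primrec.snd (Primrec.const 2))
      (Primrec.nat_add.comp Primrec.snd (Primrec.const 10))
  have harg : Primrec fun p : PureIneqInput × ℕ => (p.1.1, p.1.2.1, p.2) :=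
    (Primrec.fst.comp Primrec.fst).pair
      ((Primrec.fst.comp (Primrec.snd.comp Primrec.fst)).pair Primrec.snd)
  exact Primrec.nat_add.to_comp.comp hpow.to_comp (hf.comp harg.to_comp)

theorem primrec_iterationCount :
    Primrec fun x : PureIneqInput => (x.2.2.1.length + 3) ^ 2 + 3 := by
  have hlen : Primrec fun x : PureIneqInput => x.2.2.1.length + 3 :=
    Primrec.nat_add.comp (Primrec.list_length.comp
      (Primrec.fst.comp (Primrec.snd.comp Primrec.snd))) (Primrec.const 3)
  have hpow : Primrec fun x : PureIneqInput => (x.2.2.1.length + 3) ^ 2 :=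
    Primrec.nat_pow.comp hlen (Primrec.const 2)
  exact Primrec.nat_add.comp hpow (Primrec.const 3)

/-! ### The decision procedure -/

/-- A bound for the exponents of some solution, if there is one. -/
def exponentBound (f : ℕ × ℕ × ℕ → ℕ) (x : PureIneqInput) : ℕ :=
  (growth f x)^[(x.2.2.1.length + 3) ^ 2 + 3] (inputSize x)

theorem computable_exponentBound {f : ℕ × ℕ × ℕ → ℕ} (hf : Computable f) :
    Computable (exponentBound f) :=
  Computable.nat_iterate primrec_iterationCount.to_comp primrec_inputSize.to_comp
    (computable_growth hf)

theorem pureIneqSolvable_iff_boundedlySolvable {f : ℕ × ℕ × ℕ → ℕ} {α β : ℕ} (hα : 1 < α)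
    (hβ : 1 < β) (hf : ∀ x, HasApproximation α β x (f (α, β, x))) {l r : ℕ} {z : Fin l → ℕ}
    (hz : ∀ j, z j = α ∨ z j = β) (A : Matrix (Fin r) (Fin l) ℤ) :
    PureIneqSolvable z A ↔
      BoundedlySolvable (pureIneqInput α β z A) (exponentBound f (pureIneqInput α β z A)) := by
  have hsize : α + β + l + 2 ≤ inputSize (pureIneqInput α β z A) := by
    have hlen : (List.ofFn z).length = l := List.length_ofFn
    refine Nat.add_le_add_right (le_trans (le_of_eq ?_) (Nat.le_add_right _ _)) 2
    exact congrArg (α + β + ·) hlen.symm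
  rw [boundedlySolvable_iff,
    pureIneqSolvable_iff_exists_le hα hβ (Φ := growth f (pureIneqInput α β z A))
      (C := inputSize (pureIneqInput α β z A)) (fun x => (hf x).mono (Nat.le_add_left _ _))
      (fun x => Nat.le_add_right _ _) hz (by omega) (by omega) (by omega) (by omega)
      (abs_le_inputSize α β z A)]
  have hlen : (pureIneqInput α β z A).2.2.1.length = l := List.length_ofFn
  rw [exponentBound, hlen]

theorem exists_computable_decider {f : ℕ × ℕ × ℕ → ℕ} (hf : Computable f) :
    ∃ decider : PureIneqInput → Bool, Computable decider ∧
      ∀ x, decider x = true ↔ BoundedlySolvable x (exponentBound f x) := by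
  obtain ⟨inst, h⟩ := primrecPred_boundedlySolvable
  have hdec := h.to_comp
  generalize hg : (fun p : PureIneqInput × ℕ => decide (BoundedlySolvable p.1 p.2)) = g at hdec
  have hspec : ∀ p, g p = true ↔ BoundedlySolvable p.1 p.2 := by
    intro p
    rw [← hg, decide_eq_true_iff]
  have harg : Computable fun x : PureIneqInput => (x, exponentBound f x) :=
    Computable.id.pair (computable_exponentBound hf)
  exact ⟨fun x => g (x, exponentBound f x), hdec.comp harg, fun x => hspec _⟩

/-- One algorithm (a total computable function), uniform in all the data, decides the inequality
problem on every input that satisfies the hypotheses. -/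
theorem mainTheorem6 :
    ∃ decider : PureIneqInput → Bool, Computable decider ∧
      ∀ (α β : ℕ), 1 < α → 1 < β → MultiplicativelyIndependent α β →
      ∀ (l r : ℕ), 1 ≤ l → 0 < r →
      ∀ (z : Fin l → ℕ), (∀ j, z j = α ∨ z j = β) →
      ∀ (A : Matrix (Fin r) (Fin l) ℤ),
        decider (pureIneqInput α β z A) = true ↔ PureIneqSolvable z A := by
  obtain ⟨f, hf, happ⟩ := exists_computable_approximation
  obtain ⟨decider, hdec, hspec⟩ := exists_computable_decider hf
  refine ⟨decider, hdec, ?_⟩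
  intro α β hα hβ hind l r _ _ z hz A
  rw [hspec]
  exact (pureIneqSolvable_iff_boundedlySolvable hα hβ (fun x => happ α β x hα hβ hind) hz A).symm
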